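/- Let $\eta$ be a Borel probability measure on $SU(2)$ whose support generates a dense subgroup of $SU(2)$. For $d\ge 2$ identify $\{0,\dots,d-1\}$ with $\mathbb Z/d\mathbb Z$, let $e_0,\dots,e_{d-1}$ be the standard basis of $\mathbb C^d$, and for $i\in\mathbb Z/d\mathbb Z$ let $\nu_{i,i+1}$ be the probability measure on $SU(d)$ which is the image of $\eta$ under the embedding of $SU(2)$ into $SU(d)$ in which $\gamma\in SU(2)$ acts as $\gamma$ on the span of $(e_i,e_{i+1})$ and fixes the other basis vectors. Consider the random walk $X_{n+1}=g_{n+1}X_n$ on $SU(d)$, where $g_1,g_2,\dots$ are independent with law $\nu=\frac1d\sum_{i\in\mathbb Z/d\mathbb Z}\nu_{i,i+1}$; equivalently, the walk with transition operator $$Tf(x)=\frac1d\sum_{i=0}^{d-1}\int f(gx)\,\nu_{i,i+1}(dg).$$ Call a probability measure $\mu$ on $SU(d)$ an $\varepsilon$-approximation of the Haar probability measure $m$ if $\left|\int f\,d\mu-\int f\,dm\right|\le\varepsilon$ for every $f:SU(d)\to\mathbb R$ that is $1$-Lipschitz with respect to the operator norm distance $\|g-h\|$. Then there is a constant $C>0$,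 depending on $\eta$ but not on $d$, such that for all $d\ge2$ and all $0<\varepsilon\le\frac12$ there is an integer $0\le n_0\le C\left(d\log\frac1\varepsilon\right)^C$ such that for every $n\ge n_0$ and every starting point $X_0=x\in SU(d)$, the law of $X_n$ is an $\varepsilon$-approximation of $m$. (No spectral gap is assumed.) -/

import Mathlib

open MeasureTheory Matrix

/-- The special unitary group `SU(d)`, with the topology inherited from the matrices. -/
abbrev SU (d : ℕ) : Type := ↥(Matrix.specialUnitaryGroup (Fin d) ℂ)

namespace SU

/-- `SU(d)` carries its Borel σ-algebra. -/
noncomputable instance instMeasurableSpace (d : ℕ) : MeasurableSpace (SU d) := borel (SU d)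

instance instBorelSpace (d : ℕ) : BorelSpace (SU d) := ⟨rfl⟩

instance instSecondCountable (d : ℕ) : SecondCountableTopology (SU d) :=
  haveI : SecondCountableTopology (Matrix (Fin d) (Fin d) ℂ) :=
    inferInstanceAs (SecondCountableTopology (Fin d → Fin d → ℂ))
  TopologicalSpace.Subtype.secondCountableTopology _

instance instIsTopologicalGroup (d : ℕ) : IsTopologicalGroup (SU d) where
  continuous_mul := by fun_prop
  continuous_inv := by
    refine Continuous.subtype_mk ?_ _
    exact continuous_subtype_val.matrix_conjTranspose

instance instCompactSpace (d : ℕ) : CompactSpace (SU d) := by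
  refine isCompact_iff_compactSpace.1 ?_
  have hK : IsCompact (Set.univ.pi fun _ : Fin d => Set.univ.pi fun _ : Fin d =>
      Metric.closedBall (0 : ℂ) 1) :=
    isCompact_univ_pi fun _ => isCompact_univ_pi fun _ => isCompact_closedBall _ _
  refine IsCompact.of_isClosed_subset hK ?_ ?_
  · have h : ((Matrix.specialUnitaryGroup (Fin d) ℂ : Set (Matrix (Fin d) (Fin d) ℂ))) =
        {A | A * Aᴴ = 1} ∩ {A | A.det = 1} := by
      ext A
      simp [Matrix.mem_specialUnitaryGroup_iff, Matrix.mem_unitaryGroup_iff,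
        Matrix.star_eq_conjTranspose]
    rw [h]
    exact (isClosed_eq (continuous_id.mul continuous_id.matrix_conjTranspose)
      continuous_const).inter (isClosed_eq continuous_id.matrix_det continuous_const)
  · intro A hA i _ j _
    simpa using entry_norm_bound_of_unitary
      (Matrix.mem_specialUnitaryGroup_iff.1 hA).1 i j

/-- The Haar probability measure on `SU(d)`. -/
noncomputable def haar (d : ℕ) : Measure (SU d) := Measure.haarMeasure ⊤

instance instIsProbabilityMeasureHaar (d : ℕ) : IsProbabilityMeasure (haar d) :=
  ⟨by simpa [haar] using Measure.haarMeasure_self (K₀ := (⊤ : TopologicalSpace.PositiveCompacts (SU d)))⟩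

/-- The distance `‖g - h‖` on `SU(d)`, where `‖·‖` is the operator norm on the Hermitian space
`ℂ^d`. -/
noncomputable def opDist {d : ℕ} (g h : SU d) : ℝ :=
  ‖Matrix.toEuclideanCLM (n := Fin d) (𝕜 := ℂ) (g.1 - h.1)‖

/-- The `d × 2` matrix whose two columns are the basis vectors `e_i` and `e_j`. -/
def pairIncl {d : ℕ} (i j : Fin d) : Matrix (Fin d) (Fin 2) ℂ :=
  Matrix.of fun a k => if a = ![i, j] k then 1 else 0

theorem pairIncl_isometry {d : ℕ} {i j : Fin d} (hij : i ≠ j) :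
    (pairIncl i j)ᴴ * pairIncl i j = 1 := by
  have h : ∀ k l : Fin 2, ![i, j] k = ![i, j] l ↔ k = l := by
    intro k l
    fin_cases k <;> fin_cases l <;> simp [hij, hij.symm]
  ext k l
  rw [Matrix.mul_apply, Finset.sum_eq_single (![i, j] k)]
  · simp only [pairIncl, Matrix.conjTranspose_apply, Matrix.of_apply, h, Matrix.one_apply]
    simp
  · intro a _ ha
    simp only [pairIncl, Matrix.conjTranspose_apply, Matrix.of_apply, ha]
    simp
  · simp

/-- The matrix acting as `γ` on the span of `e_i, e_j` (in the ordered basis `(e_i, e_j)`) and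
fixing all other basis vectors. -/
def embedMatrix {d : ℕ} (i j : Fin d) (γ : Matrix (Fin 2) (Fin 2) ℂ) : Matrix (Fin d) (Fin d) ℂ :=
  1 + pairIncl i j * ((γ - 1) * (pairIncl i j)ᴴ)

theorem embedMatrix_mul_pairIncl {d : ℕ} {i j : Fin d} (hij : i ≠ j)
    (γ : Matrix (Fin 2) (Fin 2) ℂ) :
    embedMatrix i j γ * pairIncl i j = pairIncl i j * γ := by
  rw [embedMatrix, Matrix.add_mul, Matrix.mul_assoc, Matrix.mul_assoc, pairIncl_isometry hij]
  simp [Matrix.mul_sub]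

theorem embedMatrix_mulVec_single {d : ℕ} {i j k : Fin d} (hi : k ≠ i) (hj : k ≠ j)
    (γ : Matrix (Fin 2) (Fin 2) ℂ) :
    embedMatrix i j γ *ᵥ Pi.single k 1 = Pi.single k 1 := by
  have h : (pairIncl i j)ᴴ *ᵥ Pi.single k 1 = 0 := by
    ext l
    fin_cases l <;> simp [pairIncl, hi, hj]
  rw [embedMatrix, Matrix.add_mulVec, ← Matrix.mulVec_mulVec, ← Matrix.mulVec_mulVec, h,
    Matrix.one_mulVec, Matrix.mulVec_zero, Matrix.mulVec_zero, add_zero]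

theorem embedMatrix_mul {d : ℕ} {i j : Fin d} (hij : i ≠ j) (γ δ : Matrix (Fin 2) (Fin 2) ℂ) :
    embedMatrix i j γ * embedMatrix i j δ = embedMatrix i j (γ * δ) := by
  conv_lhs => rw [embedMatrix.eq_1 i j δ]
  rw [Matrix.mul_add, ← Matrix.mul_assoc, embedMatrix_mul_pairIncl hij, embedMatrix, embedMatrix,
    Matrix.mul_one, add_assoc, Matrix.mul_assoc, ← Matrix.mul_add, ← Matrix.mul_assoc,
    ← Matrix.add_mul]
  congr 3
  noncomm_ring

theorem embedMatrix_mem {d : ℕ} {i j : Fin d} (hij : i ≠ j) (γ : SU 2) :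
    embedMatrix i j γ.1 ∈ Matrix.specialUnitaryGroup (Fin d) ℂ := by
  obtain ⟨hu, hdet⟩ := Matrix.mem_specialUnitaryGroup_iff.1 γ.2
  refine Matrix.mem_specialUnitaryGroup_iff.2 ⟨?_, ?_⟩
  · rw [Matrix.mem_unitaryGroup_iff, Matrix.star_eq_conjTranspose] at hu ⊢
    have h : (embedMatrix i j γ.1)ᴴ = embedMatrix i j (γ.1)ᴴ := by
      simp [embedMatrix, Matrix.conjTranspose_mul, Matrix.mul_assoc]
    rw [h, embedMatrix_mul hij, hu]
    simp [embedMatrix]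
  · rw [embedMatrix, Matrix.det_one_add_mul_comm, Matrix.mul_assoc, pairIncl_isometry hij]
    simpa using hdet

/-- The element `γ_{ij}` of `SU(d)` given by `γ ∈ SU(2)` acting on `[e_i, e_j]`. -/
def embed {d : ℕ} {i j : Fin d} (hij : i ≠ j) (γ : SU 2) : SU d :=
  ⟨embedMatrix i j γ.1, embedMatrix_mem hij γ⟩

theorem continuous_embed {d : ℕ} {i j : Fin d} (hij : i ≠ j) : Continuous (embed hij) := by
  refine Continuous.subtype_mk ?_ _
  unfold embedMatrix
  fun_prop

theorem ne_add_one {d : ℕ} [d.AtLeastTwo] (i : Fin d) : i ≠ i + 1 := by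
  have h : 2 ≤ d := Nat.AtLeastTwo.prop
  simp
  omega

/-- The step distribution `ν = (1/d) ∑_{i ∈ ℤ/d} ν_{i,i+1}` on `SU(d)`, where `ν_{i,i+1}` is the
image of `η` under `γ ↦ γ_{i,i+1}`; addition in `Fin d` is modulo `d`. -/
noncomputable def stepMeasure (η : Measure (SU 2)) (d : ℕ) [d.AtLeastTwo] : Measure (SU d) :=
  (d : ENNReal)⁻¹ • ∑ i : Fin d, η.map (embed (ne_add_one i))

/-- The law after `n` steps of the random walk `X_{n+1} = g_{n+1} X_n` on `SU(d)` started at `x`,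
with `g_1, g_2, …` independent of law `stepMeasure η d`. -/
noncomputable def walkLaw (η : Measure (SU 2)) (d : ℕ) [d.AtLeastTwo] (x : SU d) :
    ℕ → Measure (SU d)
  | 0 => Measure.dirac x
  | n + 1 => (stepMeasure η d).mconv (walkLaw η d x n)

instance instIsProbabilityMeasureStep (η : Measure (SU 2)) [IsProbabilityMeasure η] (d : ℕ)
    [d.AtLeastTwo] : IsProbabilityMeasure (stepMeasure η d) := by
  have h : ∀ i : Fin d, (η.map (embed (ne_add_one i))) Set.univ = 1 := fun i => by
    rw [Measure.map_apply (continuous_embed _).measurable MeasurableSet.univ]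
    simp
  refine ⟨?_⟩
  have hd : (d : ENNReal) ≠ 0 := by exact_mod_cast NeZero.ne d
  simp [stepMeasure, h, ENNReal.inv_mul_cancel hd]

instance instIsProbabilityMeasureWalk (η : Measure (SU 2)) [IsProbabilityMeasure η] (d : ℕ)
    [d.AtLeastTwo] (x : SU d) (n : ℕ) : IsProbabilityMeasure (walkLaw η d x n) := by
  induction n with
  | zero => exact inferInstanceAs (IsProbabilityMeasure (Measure.dirac x))
  | succ n ih =>
    exact inferInstanceAs (IsProbabilityMeasure ((stepMeasure η d).mconv (walkLaw η d x n)))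

/-- `μ` is an `ε`-approximation of the Haar measure: the integrals of every `1`-Lipschitz function
on `SU(d)` against the two measures differ by at most `ε`
(that is, their Kantorovich-Wasserstein distance is at most `ε`). -/
def IsHaarApprox {d : ℕ} (μ : Measure (SU d)) (ε : ℝ) : Prop :=
  ∀ f : SU d → ℝ, (∀ g h : SU d, |f g - f h| ≤ opDist g h) →
    |∫ g, f g ∂μ - ∫ g, f g ∂(haar d)| ≤ ε

end SU

/-! The $L^2$ mass that `f` loses in one step of the walk is the $\nu$-average of
$\|f(g\,\cdot)-Tf\|^2$, so a small loss means that typical steps translate `f` to nearly the same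
function. On the other hand a mean-zero `f` cannot have small displacement $\|f-f(g\,\cdot)\|$ for
all `g` unless its own norm is small (`l2_le_of_displacement_le`). The proof turns small loss into
small displacement, with constants polynomial in `d`.

A point of $SU(2)$ is controlled if, at every scale, some nearby point displaces `f` by at most $C
d^m$ times the square root of the mass lost in `m` steps, with `C`, `m` independent of `d`, `f` and
the embedding. Controlled points form a closed subgroup `H`. It contains $kl^{-1}$ for `k`, `l` in
the support of `η`, and the support conjugates it into itself, because `f` may be replaced by $Tf$
at the price of one more step. Hence $SU(2)/H$ is abelian (`Subgroup.commutator_mem_of_dense`); as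
every element of $SU(2)$ is a commutator, `H` is everything, and compactness makes `C`, `m` uniform
at scale 1/128.

Displacement is subadditive and inversion invariant, so the Solovay-Kitaev argument applies to it as
to a word length: an error $\exp(-\log 2\,(3/2)^k)$ costs a factor $5^k$, and for Lipschitz `f` the
error is itself a displacement bound. Givens rotations pass from $SU(2)$ to $SU(d)$ at a cost of
$d^2$ (`length_le_of_embed_le`). Therefore, as long as the norm exceeds `δ`, its square shrinks by
$1-1/B^2$ every `m` steps, with `B` polynomial in `d` and $\log(1/\delta)$ (`l2_iterate_le`). The
rate may depend on $\log\delta$, which is why no spectral gap is needed.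

A Lipschitz function that is small in $L^2$ is uniformly small, by a lower bound for the volume of
balls (`abs_le_of_l2_le`). The required `δ` has $\log(1/\delta)$ polynomial in
$d\log(1/\varepsilon)$. -/

set_option linter.unusedSectionVars false

/-! ### Displacement and energy loss in $L^2$ of a compact group -/

namespace CompactWalk

section

variable {G : Type*} [Group G] [TopologicalSpace G] [IsTopologicalGroup G]

/-- The left translate `x ↦ f (g * x)` of a continuous function. -/
def translate (g : G) (f : C(G, ℝ)) : C(G, ℝ) := ⟨fun x => f (g * x), by fun_prop⟩

@[simp]
theorem translate_apply (g : G) (f : C(G, ℝ)) (x : G) : translate g f x = f (g * x) := rfl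

theorem translate_translate (g h : G) (f : C(G, ℝ)) :
    translate h (translate g f) = translate (g * h) f := by
  ext x; simp [mul_assoc]

@[simp]
theorem translate_one (f : C(G, ℝ)) : translate 1 f = f := by ext x; simp

theorem translate_sub (g : G) (f₁ f₂ : C(G, ℝ)) :
    translate g (f₁ - f₂) = translate g f₁ - translate g f₂ := by
  ext x; simp

variable [CompactSpace G] [MeasurableSpace G] [BorelSpace G] [SecondCountableTopology G]

theorem integrable_continuousMap (μ : Measure G) [IsFiniteMeasure μ] (f : C(G, ℝ)) :
    Integrable f μ :=
  f.continuous.integrable_of_hasCompactSupport (HasCompactSupport.of_compactSpace _)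

/-- The `L²` seminorm of a continuous function on a compact group. -/
noncomputable def l2 (m : Measure G) [IsFiniteMeasure m] (f : C(G, ℝ)) : ℝ :=
  ‖ContinuousMap.toLp 2 m ℝ f‖

section l2

variable (m : Measure G) [IsFiniteMeasure m]

theorem l2_nonneg (f : C(G, ℝ)) : 0 ≤ l2 m f := norm_nonneg _

theorem l2_sq (f : C(G, ℝ)) : l2 m f ^ 2 = ∫ x, f x ^ 2 ∂m := by
  rw [l2, ← real_inner_self_eq_norm_sq, L2.inner_def]
  refine integral_congr_ae ?_
  filter_upwards [ContinuousMap.coeFn_toLp (p := 2) (𝕜 := ℝ) m f] with x hx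
  rw [hx]; simp [sq]

theorem l2_sub_le (f g h : C(G, ℝ)) : l2 m (f - h) ≤ l2 m (f - g) + l2 m (g - h) := by
  simp only [l2, map_sub]
  exact norm_sub_le_norm_sub_add_norm_sub _ _ _

theorem l2_sub_comm (f g : C(G, ℝ)) : l2 m (f - g) = l2 m (g - f) := by
  simp only [l2, map_sub]; exact norm_sub_rev _ _

theorem l2_le_of_sq_le {f : C(G, ℝ)} {a : ℝ} (ha : 0 ≤ a) (h : ∫ x, f x ^ 2 ∂m ≤ a ^ 2) :
    l2 m f ≤ a := by
  rw [← l2_sq] at h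
  exact le_of_sq_le_sq h ha

end l2

section haar

variable (m : Measure G) [IsProbabilityMeasure m] [m.IsMulLeftInvariant]

theorem l2_le_of_abs_le {f : C(G, ℝ)} {a : ℝ} (h : ∀ x, |f x| ≤ a) : l2 m f ≤ a := by
  have ha : 0 ≤ a := (abs_nonneg _).trans (h 1)
  refine l2_le_of_sq_le m ha ?_
  calc ∫ x, f x ^ 2 ∂m ≤ ∫ _, a ^ 2 ∂m := by
        refine integral_mono (integrable_continuousMap m (f ^ 2)) (integrable_const _) fun x => ?_
        exact sq_le_sq' (neg_le_of_abs_le (h x)) (le_of_abs_le (h x))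
    _ = a ^ 2 := by simp

theorem l2_translate (g : G) (f : C(G, ℝ)) : l2 m (translate g f) = l2 m f := by
  have h : l2 m (translate g f) ^ 2 = l2 m f ^ 2 := by
    rw [l2_sq, l2_sq]
    exact integral_mul_left_eq_self (fun x => f x ^ 2) g
  exact (pow_left_inj₀ (l2_nonneg _ _) (l2_nonneg _ _) two_ne_zero).1 h

/-- The `L²` displacement of `f` under translation by `g`. -/
noncomputable def displacement (f : C(G, ℝ)) (g : G) : ℝ := l2 m (f - translate g f)

theorem displacement_nonneg (f : C(G, ℝ)) (g : G) : 0 ≤ displacement m f g := l2_nonneg _ _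

/-- Conjugating the group element amounts to translating the function; this is what lets control be
transported by conjugation. -/
theorem displacement_conj (f : C(G, ℝ)) (k g : G) :
    displacement m f (k * g * k⁻¹) = displacement m (translate k f) g := by
  rw [displacement, displacement, ← l2_translate m k (f - _), translate_sub, translate_translate,
    translate_translate]
  simp

theorem displacement_mul_le (f : C(G, ℝ)) (g h : G) :
    displacement m f (g * h) ≤ displacement m f g + displacement m f h := by
  refine (l2_sub_le m f (translate h f) _).trans ?_
  rw [← translate_translate, ← translate_sub, l2_translate]
  simp only [displacement]
  linarith

theorem displacement_inv (f : C(G, ℝ)) (g : G) :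
    displacement m f g⁻¹ = displacement m f g := by
  rw [displacement, displacement, ← l2_translate m g, translate_sub, translate_translate,
    l2_sub_comm]
  simp

theorem displacement_mul_inv (f : C(G, ℝ)) (g h : G) :
    displacement m f (g * h⁻¹) = l2 m (translate h f - translate g f) := by
  rw [displacement, ← l2_translate m h, translate_sub, translate_translate]
  simp

theorem displacement_le_add (f₁ f₂ : C(G, ℝ)) (g : G) :
    displacement m f₁ g ≤ displacement m f₂ g + 2 * l2 m (f₁ - f₂) := by
  have h1 := l2_sub_le m f₁ f₂ (translate g f₁)
  have h2 := l2_sub_le m f₂ (translate g f₂) (translate g f₁)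
  rw [← translate_sub, l2_translate, l2_sub_comm m f₂ f₁] at h2
  simp only [displacement]
  linarith

theorem isMulRightInvariant_of_isProbabilityMeasure (m : Measure G) [IsProbabilityMeasure m]
    [m.IsHaarMeasure] : m.IsMulRightInvariant := by
  refine ⟨fun g => ?_⟩
  have : IsProbabilityMeasure (m.map (· * g)) :=
    Measure.isProbabilityMeasure_map (measurable_mul_const g).aemeasurable
  exact Measure.isHaarMeasure_eq_of_isProbabilityMeasure _ _

/-- The variance of a function is bounded by its largest displacement. -/
theorem l2_le_of_displacement_le (m : Measure G) [IsProbabilityMeasure m] [m.IsHaarMeasure]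
    {f : C(G, ℝ)} {a : ℝ} (hf : ∫ x, f x ∂m = 0) (h : ∀ g, displacement m f g ≤ a) :
    l2 m f ≤ a := by
  have := isMulRightInvariant_of_isProbabilityMeasure m
  have ha : 0 ≤ a := (displacement_nonneg m f 1).trans (h 1)
  refine l2_le_of_sq_le m ha ?_
  have hc : Continuous (fun p : G × G => (f p.2 - f (p.1 * p.2)) ^ 2) := by fun_prop
  have hint : Integrable (fun p : G × G => (f p.2 - f (p.1 * p.2)) ^ 2) (m.prod m) :=
    hc.integrable_of_hasCompactSupport (HasCompactSupport.of_compactSpace _)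
  -- By right invariance `g * x` is Haar distributed, and the mean-zero hypothesis kills the cross
  -- term. Averaging over `x` shows that the mean squared displacement is twice the squared norm.
  have key : ∀ x, ∫ g, (f x - f (g * x)) ^ 2 ∂m = f x ^ 2 + ∫ y, f y ^ 2 ∂m := by
    intro x
    rw [integral_mul_right_eq_self (fun y => (f x - f y) ^ 2) x]
    have e : ∀ y, (f x - f y) ^ 2 = f x ^ 2 - 2 * f x * f y + f y ^ 2 := fun y => by ring
    simp_rw [e]
    have i1 := integrable_continuousMap m f
    have i2 : Integrable (fun y => f y ^ 2) m := integrable_continuousMap m (f ^ 2)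
    rw [integral_add (by fun_prop) i2, integral_sub (by fun_prop) (by fun_prop),
      integral_const_mul, hf]
    simp
  have h1 : ∫ x, ∫ g, (f x - f (g * x)) ^ 2 ∂m ∂m = 2 * ∫ x, f x ^ 2 ∂m := by
    simp_rw [key]
    have i2 : Integrable (fun y => f y ^ 2) m := integrable_continuousMap m (f ^ 2)
    rw [integral_add i2 (integrable_const _)]
    simp; ring
  have h2 : ∫ x, ∫ g, (f x - f (g * x)) ^ 2 ∂m ∂m = ∫ g, displacement m f g ^ 2 ∂m := by
    rw [integral_integral_swap (f := fun x g => (f x - f (g * x)) ^ 2) hint.swap]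
    refine integral_congr_ae (.of_forall fun g => ?_)
    simp [displacement, l2_sq]
  have h3 : ∫ g, displacement m f g ^ 2 ∂m ≤ ∫ _, a ^ 2 ∂m := by
    have e : (fun g => displacement m f g ^ 2) = fun g => ∫ x, (f x - f (g * x)) ^ 2 ∂m := by
      ext g; simp [displacement, l2_sq]
    refine integral_mono ?_ (integrable_const _) fun g => ?_
    · rw [e]; exact hint.integral_prod_left
    · exact pow_le_pow_left₀ (displacement_nonneg _ _ _) (h g) 2
  have h4 : 0 ≤ ∫ x, f x ^ 2 ∂m := integral_nonneg fun x => sq_nonneg _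
  simp only [integral_const, probReal_univ, smul_eq_mul, one_mul] at h3
  linarith

end haar

section transition

variable (ν : Measure G) [IsProbabilityMeasure ν]

/-- The transition operator `f ↦ ∫ f (g x) dν(g)` of the left random walk. -/
noncomputable def transition (f : C(G, ℝ)) : C(G, ℝ) where
  toFun x := ∫ g, f (g * x) ∂ν
  continuous_toFun := by
    have h := continuous_parametric_integral_of_continuous (μ := ν) (X := G) (Y := G)
      (f := fun x g => f (g * x)) (by fun_prop) isCompact_univ
    simpa using h

theorem transition_apply (f : C(G, ℝ)) (x : G) : transition ν f x = ∫ g, f (g * x) ∂ν := rfl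

theorem transition_abs_le {f : C(G, ℝ)} {a : ℝ} (h : ∀ x, |f x| ≤ a) (x : G) :
    |transition ν f x| ≤ a := by
  have := norm_integral_le_of_norm_le_const (μ := ν) (f := fun g => f (g * x)) (C := a)
    (.of_forall fun g => h _)
  simpa [transition_apply] using this

theorem iterate_transition_abs_le {f : C(G, ℝ)} {a : ℝ} (h : ∀ x, |f x| ≤ a) (n : ℕ) (x : G) :
    |(transition ν)^[n] f x| ≤ a := by
  induction n generalizing f with
  | zero => exact h x
  | succ n ih => exact ih (transition_abs_le ν h)

theorem integrable_uncurry_comp_mul (m : Measure G) [IsFiniteMeasure m] (f : C(G, ℝ)) :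
    Integrable (fun p : G × G => f (p.1 * p.2)) (ν.prod m) :=
  Continuous.integrable_of_hasCompactSupport (by fun_prop) (HasCompactSupport.of_compactSpace _)

variable (m : Measure G) [IsProbabilityMeasure m] [m.IsMulLeftInvariant]

theorem integral_transition (f : C(G, ℝ)) : ∫ x, transition ν f x ∂m = ∫ x, f x ∂m := by
  simp_rw [transition_apply]
  rw [integral_integral_swap (f := fun x g => f (g * x)) (integrable_uncurry_comp_mul ν m f).swap]
  simp_rw [integral_mul_left_eq_self (fun x => f x)]
  simp

/-- The variance identity for the translates of `f`. -/
theorem integral_l2_translate_sub_transition (f : C(G, ℝ)) :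
    ∫ g, l2 m (translate g f - transition ν f) ^ 2 ∂ν = l2 m f ^ 2 - l2 m (transition ν f) ^ 2 := by
  have hc : Continuous (fun p : G × G => (f (p.1 * p.2) - transition ν f p.2) ^ 2) := by fun_prop
  have hint : Integrable (fun p : G × G => (f (p.1 * p.2) - transition ν f p.2) ^ 2) (ν.prod m) :=
    hc.integrable_of_hasCompactSupport (HasCompactSupport.of_compactSpace _)
  -- For fixed `x` this is the variance of `g ↦ f (g * x)` under `ν`.
  have hv : ∀ x, ∫ g, (f (g * x) - transition ν f x) ^ 2 ∂ν =
      transition ν (f ^ 2) x - transition ν f x ^ 2 := by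
    intro x
    have i1 : Integrable (fun g => f (g * x)) ν :=
      integrable_continuousMap ν ⟨fun g => f (g * x), by fun_prop⟩
    have i2 : Integrable (fun g => f (g * x) ^ 2) ν :=
      integrable_continuousMap ν ⟨fun g => f (g * x) ^ 2, by fun_prop⟩
    have e : ∀ g, (f (g * x) - transition ν f x) ^ 2 =
      f (g * x) ^ 2 - 2 * transition ν f x * f (g * x) + transition ν f x ^ 2 := fun g => by ring
    simp_rw [e]
    have i3 := i1.const_mul (2 * transition ν f x)
    have i4 := i2.sub i3
    simp only [Pi.sub_def] at i4
    rw [integral_add i4 (integrable_const _), integral_sub i2 i3, integral_const_mul, ← transition_apply ν f x]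
    simp [transition_apply ν (f ^ 2)]
    ring
  calc ∫ g, l2 m (translate g f - transition ν f) ^ 2 ∂ν
      = ∫ g, ∫ x, (f (g * x) - transition ν f x) ^ 2 ∂m ∂ν := by simp [l2_sq]
    _ = ∫ x, ∫ g, (f (g * x) - transition ν f x) ^ 2 ∂ν ∂m := integral_integral_swap hint
    _ = ∫ x, (transition ν (f ^ 2) x - transition ν f x ^ 2) ∂m := by simp_rw [hv]
    _ = _ := by
      have i2 : Integrable (fun y => transition ν f y ^ 2) m :=
        integrable_continuousMap m (transition ν f ^ 2)
      rw [integral_sub (integrable_continuousMap m _) i2, integral_transition, l2_sq, l2_sq]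
      rfl

theorem l2_transition_le (f : C(G, ℝ)) : l2 m (transition ν f) ≤ l2 m f := by
  have h := integral_l2_translate_sub_transition ν m f
  have h0 : 0 ≤ ∫ g, l2 m (translate g f - transition ν f) ^ 2 ∂ν :=
    integral_nonneg fun g => sq_nonneg _
  exact le_of_sq_le_sq (by linarith) (l2_nonneg m f)

theorem l2_iterate_transition_le (f : C(G, ℝ)) (n : ℕ) : l2 m ((transition ν)^[n] f) ≤ l2 m f := by
  induction n generalizing f with
  | zero => exact le_rfl
  | succ n ih => exact (ih _).trans (l2_transition_le ν m f)

theorem continuous_l2_translate_sub (f h : C(G, ℝ)) :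
    Continuous fun g => l2 m (translate g f - h) := by
  have e : (fun g => l2 m (translate g f - h)) =
      fun g => √(∫ x, (f (g * x) - h x) ^ 2 ∂m) := by
    ext g
    rw [← Real.sqrt_sq (l2_nonneg m _), l2_sq]
    simp
  rw [e]
  have h := continuous_parametric_integral_of_continuous (μ := m) (X := G) (Y := G)
      (f := fun g x => (f (g * x) - h x) ^ 2) (by fun_prop) isCompact_univ
  simp only [Measure.restrict_univ] at h
  exact h.sqrt

/-- The square root of the loss of `L²` mass of `f` after `n` steps. -/
noncomputable def energyLoss (n : ℕ) (f : C(G, ℝ)) : ℝ :=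
  √(l2 m f ^ 2 - l2 m ((transition ν)^[n] f) ^ 2)

theorem energyLoss_nonneg (n : ℕ) (f : C(G, ℝ)) : 0 ≤ energyLoss ν m n f := Real.sqrt_nonneg _

theorem energyLoss_sq (n : ℕ) (f : C(G, ℝ)) :
    energyLoss ν m n f ^ 2 = l2 m f ^ 2 - l2 m ((transition ν)^[n] f) ^ 2 :=
  Real.sq_sqrt (sub_nonneg.2
    (pow_le_pow_left₀ (l2_nonneg _ _) (l2_iterate_transition_le ν m f n) 2))

theorem energyLoss_mono {n n' : ℕ} (h : n ≤ n') (f : C(G, ℝ)) :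
    energyLoss ν m n f ≤ energyLoss ν m n' f := by
  refine Real.sqrt_le_sqrt (sub_le_sub_left ?_ _)
  obtain ⟨k, rfl⟩ := Nat.exists_eq_add_of_le h
  rw [add_comm, Function.iterate_add_apply]
  exact pow_le_pow_left₀ (l2_nonneg _ _) (l2_iterate_transition_le ν m _ k) 2

/-- Both sides end at the same iterate, and the left one starts from the smaller norm. This allows a
bound for `transition ν f` to be charged to `f`. -/
theorem energyLoss_transition_le (n : ℕ) (f : C(G, ℝ)) :
    energyLoss ν m n (transition ν f) ≤ energyLoss ν m (n + 1) f := by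
  refine Real.sqrt_le_sqrt ?_
  rw [Function.iterate_succ_apply]
  exact sub_le_sub_right (pow_le_pow_left₀ (l2_nonneg _ _) (l2_transition_le ν m f) 2) _

end transition

end

end CompactWalk

/-! ### The bi-invariant metric on $SU(d)$ and the embeddings of $SU(2)$ -/

namespace SU

section distance

open scoped Matrix.Norms.L2Operator

variable {d : ℕ}

theorem opDist_eq_norm (g h : SU d) : opDist g h = ‖g.1 - h.1‖ := rfl

theorem coe_mul (g h : SU d) : (g * h).1 = g.1 * h.1 := rfl

theorem norm_mul_coe (A : Matrix (Fin d) (Fin d) ℂ) (g : SU d) : ‖A * g.1‖ = ‖A‖ :=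
  CStarRing.norm_mul_mem_unitary A (Matrix.mem_specialUnitaryGroup_iff.1 g.2).1

theorem norm_coe_mul (A : Matrix (Fin d) (Fin d) ℂ) (g : SU d) : ‖g.1 * A‖ = ‖A‖ :=
  CStarRing.norm_mem_unitary_mul A (Matrix.mem_specialUnitaryGroup_iff.1 g.2).1

theorem opDist_mul_left (k g h : SU d) : opDist (k * g) (k * h) = opDist g h := by
  rw [opDist_eq_norm, coe_mul, coe_mul, ← mul_sub, norm_coe_mul, opDist_eq_norm]

theorem opDist_mul_right (k g h : SU d) : opDist (g * k) (h * k) = opDist g h := by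
  rw [opDist_eq_norm, coe_mul, coe_mul, ← sub_mul, norm_mul_coe, opDist_eq_norm]

theorem opDist_comm (g h : SU d) : opDist g h = opDist h g := by
  simp only [opDist_eq_norm]; exact norm_sub_rev _ _

theorem opDist_self (g : SU d) : opDist g g = 0 := by simp [opDist_eq_norm]

theorem opDist_nonneg (g h : SU d) : 0 ≤ opDist g h := norm_nonneg _

theorem opDist_triangle (g h k : SU d) : opDist g k ≤ opDist g h + opDist h k := by
  simp only [opDist_eq_norm]; exact norm_sub_le_norm_sub_add_norm_sub _ _ _

theorem opDist_inv (g h : SU d) : opDist g⁻¹ h⁻¹ = opDist g h := by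
  rw [← opDist_mul_left g, ← opDist_mul_right h, opDist_comm]
  simp

theorem opDist_mul_le (g g' h h' : SU d) :
    opDist (g * h) (g' * h') ≤ opDist g g' + opDist h h' := by
  refine (opDist_triangle _ (g' * h) _).trans ?_
  rw [opDist_mul_left, opDist_mul_right]

theorem opDist_le_two (g h : SU d) : opDist g h ≤ 2 := by
  have h1 : ∀ g : SU d, ‖g.1‖ ≤ 1 := fun g => by
    rcases Nat.eq_zero_or_pos d with rfl | hd
    · rw [Subsingleton.elim g.1 0]; simp
    · have : Nontrivial (Matrix (Fin d) (Fin d) ℂ) := by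
        have : Nonempty (Fin d) := ⟨⟨0, hd⟩⟩
        infer_instance
      exact (CStarRing.norm_of_mem_unitary (Matrix.mem_specialUnitaryGroup_iff.1 g.2).1).le
  rw [opDist_eq_norm]
  exact (norm_sub_le g.1 h.1).trans (by linarith [h1 g, h1 h])

theorem continuous_opDist_left (g : SU d) : Continuous fun h => opDist g h := by
  simp only [opDist_eq_norm]
  fun_prop

theorem opDist_lt_mem_nhds (g : SU d) {r : ℝ} (hr : 0 < r) : {h | opDist g h < r} ∈ nhds g := by
  refine (isOpen_lt (continuous_opDist_left g) continuous_const).mem_nhds ?_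
  simpa [opDist_self] using hr

/-- A group commutator depends on its entries to second order near the identity. -/
theorem opDist_commutator_le {V W V' W' : SU d} {r s : ℝ} (hV : opDist V 1 ≤ s)
    (hW : opDist W 1 ≤ s) (hV' : opDist V V' ≤ r) (hW' : opDist W W' ≤ r)
    (hc : opDist (V * W * V⁻¹ * W⁻¹) 1 ≤ s ^ 2) :
    opDist (V * W * V⁻¹ * W⁻¹) (V' * W' * V'⁻¹ * W'⁻¹) ≤ 2 * r * s ^ 2 + 4 * r * s + 2 * r ^ 2 := by
  have hr : 0 ≤ r := (opDist_nonneg _ _).trans hV'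
  have hs : 0 ≤ s := (opDist_nonneg _ _).trans hV
  set c := V * W * V⁻¹ * W⁻¹ with hcdef
  rw [← opDist_mul_right (W' * V')]
  have e1 : V' * W' * V'⁻¹ * W'⁻¹ * (W' * V') = V' * W' := by group
  have e2 : c.1 * (W.1 * V.1) = V.1 * W.1 := by
    rw [← coe_mul, ← coe_mul, ← coe_mul, hcdef]; congr 1; group
  rw [e1]
  -- Additive commutators do not change when 1 is subtracted from an entry, so every term pairs a
  -- perturbation of size O(r) with a further small factor.
  have e3 : (c * (W' * V')).1 - (V' * W').1 =
      (c.1 - 1) * (W'.1 * V'.1 - W.1 * V.1) +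
      (((W'.1 - W.1) * (V'.1 - 1) - (V'.1 - 1) * (W'.1 - W.1)) +
       ((W.1 - 1) * (V'.1 - V.1) - (V'.1 - V.1) * (W.1 - 1))) := by
    have : (c * (W' * V')).1 - (V' * W').1 =
        (c.1 * (W'.1 * V'.1) - c.1 * (W.1 * V.1)) - (V'.1 * W'.1 - V.1 * W.1) := by
      rw [e2]; simp only [coe_mul]; abel
    rw [this]; noncomm_ring
  rw [opDist_eq_norm, e3]
  have b1 : ‖c.1 - 1‖ ≤ s ^ 2 := hc
  have b2 : ‖W'.1 * V'.1 - W.1 * V.1‖ ≤ 2 * r := by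
    have := opDist_mul_le W' W V' V
    rw [opDist_comm W', opDist_comm V'] at this
    exact this.trans (by linarith)
  have b3 : ‖W'.1 - W.1‖ ≤ r := by rw [norm_sub_rev]; exact hW'
  have b4 : ‖V'.1 - V.1‖ ≤ r := by rw [norm_sub_rev]; exact hV'
  have b5 : ‖V'.1 - 1‖ ≤ r + s := by
    have := opDist_triangle V' V 1
    rw [opDist_comm V' V] at this
    exact this.trans (by linarith)
  have b6 : ‖W.1 - 1‖ ≤ s := hW
  have mulle : ∀ {A B : Matrix (Fin d) (Fin d) ℂ} {a b : ℝ}, ‖A‖ ≤ a → ‖B‖ ≤ b →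
      ‖A * B‖ ≤ a * b := fun {A B a b} hA hB =>
    (norm_mul_le A B).trans (mul_le_mul hA hB (norm_nonneg _) ((norm_nonneg _).trans hA))
  calc _ ≤ s ^ 2 * (2 * r) + ((r * (r + s) + (r + s) * r) + (s * r + r * s)) :=
        (norm_add_le _ _).trans (add_le_add (mulle b1 b2) ((norm_add_le _ _).trans (add_le_add
          ((norm_sub_le _ _).trans (add_le_add (mulle b3 b5) (mulle b5 b3)))
          ((norm_sub_le _ _).trans (add_le_add (mulle b6 b4) (mulle b4 b6))))))
    _ = _ := by ring

theorem embedMatrix_sub {i j : Fin d} (γ δ : Matrix (Fin 2) (Fin 2) ℂ) :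
    embedMatrix i j γ - embedMatrix i j δ = pairIncl i j * ((γ - δ) * (pairIncl i j)ᴴ) := by
  rw [embedMatrix, embedMatrix, add_sub_add_left_eq_sub, ← Matrix.mul_sub, ← Matrix.sub_mul,
    sub_sub_sub_cancel_right]

theorem opDist_embed_le {i j : Fin d} (hij : i ≠ j) (γ δ : SU 2) :
    opDist (embed hij γ) (embed hij δ) ≤ opDist γ δ := by
  have hP : ‖pairIncl i j‖ ≤ 1 := by
    have h := Matrix.l2_opNorm_conjTranspose_mul_self (pairIncl i j)
    rw [pairIncl_isometry hij, norm_one] at h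
    nlinarith [norm_nonneg (pairIncl i j)]
  have hP' : ‖(pairIncl i j)ᴴ‖ ≤ 1 := by rwa [Matrix.l2_opNorm_conjTranspose]
  change ‖embedMatrix i j γ.1 - embedMatrix i j δ.1‖ ≤ ‖γ.1 - δ.1‖
  rw [embedMatrix_sub]
  have h1 := Matrix.l2_opNorm_mul (pairIncl i j) ((γ.1 - δ.1) * (pairIncl i j)ᴴ)
  have h2 := Matrix.l2_opNorm_mul (γ.1 - δ.1) (pairIncl i j)ᴴ
  have h3 := norm_nonneg (γ.1 - δ.1)
  have h4 := norm_nonneg ((γ.1 - δ.1) * (pairIncl i j)ᴴ)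
  nlinarith

theorem embed_mul {i j : Fin d} (hij : i ≠ j) (γ δ : SU 2) :
    embed hij (γ * δ) = embed hij γ * embed hij δ :=
  Subtype.ext (embedMatrix_mul hij γ.1 δ.1).symm

theorem embed_one {i j : Fin d} (hij : i ≠ j) : embed hij (1 : SU 2) = 1 :=
  Subtype.ext (by simp [embed, embedMatrix])

theorem embed_inv {i j : Fin d} (hij : i ≠ j) (γ : SU 2) : embed hij γ⁻¹ = (embed hij γ)⁻¹ :=
  eq_inv_of_mul_eq_one_left (by rw [← embed_mul, inv_mul_cancel, embed_one])

end distance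

end SU

/-! ### Balanced commutators in $SU(2)$ and the Solovay-Kitaev argument -/

namespace SU

open scoped ComplexConjugate

/-- The element of `SU(2)` with first column `(x, y)`. -/
def ofColumn (x y : ℂ) (h : x * conj x + y * conj y = 1) : SU 2 :=
  ⟨!![x, -conj y; y, conj x], by
    refine Matrix.mem_specialUnitaryGroup_iff.2 ⟨?_, ?_⟩
    · rw [Matrix.mem_unitaryGroup_iff']
      ext i j
      fin_cases i <;> fin_cases j <;>
        simp [Matrix.mul_apply, Fin.sum_univ_two, Matrix.star_apply] <;>
        first | ring1 | linear_combination h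
    · simp [Matrix.det_fin_two]
      linear_combination h⟩

theorem conjTranspose_eq_adjugate {d : ℕ} (g : SU d) : (g.1)ᴴ = g.1.adjugate := by
  obtain ⟨hu, hd⟩ := Matrix.mem_specialUnitaryGroup_iff.1 g.2
  have h1 : (g.1)ᴴ * g.1 = 1 := Matrix.mem_unitaryGroup_iff'.1 hu
  have h2 : g.1 * g.1.adjugate = 1 := by rw [Matrix.mul_adjugate, hd, one_smul]
  exact left_inv_eq_right_inv h1 h2

theorem apply_one_one (g : SU 2) : g.1 1 1 = conj (g.1 0 0) := by
  have h := congrFun (congrFun (conjTranspose_eq_adjugate g) 0) 0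
  simpa [Matrix.adjugate_fin_two] using h.symm

theorem apply_zero_one (g : SU 2) : g.1 0 1 = -conj (g.1 1 0) := by
  have h := congrFun (congrFun (conjTranspose_eq_adjugate g) 0) 1
  simp [Matrix.adjugate_fin_two] at h
  simp [h]

theorem column_norm (g : SU 2) :
    g.1 0 0 * conj (g.1 0 0) + g.1 1 0 * conj (g.1 1 0) = 1 := by
  have hd := (Matrix.mem_specialUnitaryGroup_iff.1 g.2).2
  rw [Matrix.det_fin_two, apply_one_one, apply_zero_one] at hd
  linear_combination hd

theorem re_apply_sq_le (g : SU 2) : (g.1 0 0).re ^ 2 ≤ 1 := by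
  have h := congrArg Complex.re (column_norm g)
  simp [Complex.mul_conj, Complex.normSq_apply] at h
  nlinarith [mul_self_nonneg (g.1 0 0).im, mul_self_nonneg (g.1 1 0).re,
    mul_self_nonneg (g.1 1 0).im]

-- In $SU(2)$ the matrix $g+g^*$ is the scalar $\operatorname{tr} g$, so $(g-1)^*(g-1)$ is scalar
-- too. The distance to 1 thus determines the conjugacy class.
open scoped Matrix.Norms.L2Operator in
theorem opDist_one_sq (g : SU 2) : opDist g 1 ^ 2 = 2 - 2 * (g.1 0 0).re := by
  have h : (g.1 - 1)ᴴ * (g.1 - 1) = ((2 - 2 * (g.1 0 0).re : ℝ) : ℂ) • 1 := by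
    have h1 : (g.1)ᴴ * g.1 = 1 :=
      Matrix.mem_unitaryGroup_iff'.1 (Matrix.mem_specialUnitaryGroup_iff.1 g.2).1
    have h2 : (g.1 - 1)ᴴ * (g.1 - 1) = 1 + 1 - (g.1 + (g.1)ᴴ) := by
      rw [Matrix.conjTranspose_sub, Matrix.conjTranspose_one, sub_mul, mul_sub, h1]
      simp only [mul_one, one_mul]
      abel
    rw [h2]
    ext i j
    fin_cases i <;> fin_cases j <;>
      simp [apply_one_one, apply_zero_one, Complex.ext_iff] <;> ring
  have h3 := Matrix.l2_opNorm_conjTranspose_mul_self (g.1 - 1)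
  rw [h, norm_smul, norm_one, mul_one, Complex.norm_real, Real.norm_of_nonneg
    (by nlinarith [re_apply_sq_le g])] at h3
  rw [sq]
  exact h3.symm

/-- The condition on `z` makes it a root of the characteristic polynomial; a unit eigenvector is the
first column of `u`, and the second column is then forced. -/
theorem exists_conj_diagonal (g : SU 2) (z : ℂ) (hz : z * conj z = 1)
    (hre : z.re = (g.1 0 0).re) :
    ∃ u : SU 2, g = u * ofColumn z 0 (by simpa using hz) * u⁻¹ := by
  have hdet : (g.1 - z • 1).det = 0 := by
    have hc := column_norm g
    simp only [Matrix.det_fin_two, Matrix.sub_apply, Matrix.smul_apply, Matrix.one_apply,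
      apply_one_one g, apply_zero_one g, smul_eq_mul]
    have e1 : g.1 0 0 + conj (g.1 0 0) = z + conj z := by
      rw [Complex.add_conj, Complex.add_conj, hre]
    simp
    linear_combination hc - z * e1 - hz
  obtain ⟨v, hv0, hv⟩ := Matrix.exists_mulVec_eq_zero_iff.2 hdet
  have e0 := congrFun hv 0
  have e1 := congrFun hv 1
  simp [Matrix.mulVec, dotProduct, Fin.sum_univ_two, apply_one_one g, apply_zero_one g] at e0 e1
  set n : ℝ := √(Complex.normSq (v 0) + Complex.normSq (v 1)) with hn
  have hpos : 0 < Complex.normSq (v 0) + Complex.normSq (v 1) := by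
    rcases eq_or_ne (v 0) 0 with h | h
    · have h1 : v 1 ≠ 0 := fun h1 => hv0 (by ext i; fin_cases i <;> simp [h, h1])
      have := Complex.normSq_pos.2 h1
      have := Complex.normSq_nonneg (v 0)
      linarith
    · have := Complex.normSq_pos.2 h
      have := Complex.normSq_nonneg (v 1)
      linarith
  have hn0 : (n : ℂ) ≠ 0 := by exact_mod_cast (Real.sqrt_pos.2 hpos).ne'
  have hn2 : (n : ℂ) ^ 2 = v 0 * conj (v 0) + v 1 * conj (v 1) := by
    rw [Complex.mul_conj, Complex.mul_conj]
    exact_mod_cast Real.sq_sqrt hpos.le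
  have hu : v 0 / n * conj (v 0 / n) + v 1 / n * conj (v 1 / n) = 1 := by
    simp only [map_div₀, Complex.conj_ofReal]
    field_simp
    rw [hn2]
  refine ⟨ofColumn _ _ hu, ?_⟩
  rw [eq_mul_inv_iff_mul_eq]
  have e0' := congrArg conj e0
  have e1' := congrArg conj e1
  simp at e0' e1'
  ext i j
  fin_cases i <;> fin_cases j <;>
    simp [ofColumn, Matrix.mul_apply, Fin.sum_univ_two, apply_one_one g,
      apply_zero_one g] <;> field_simp
  · linear_combination e0
  · linear_combination -e1'
  · linear_combination e1
  · linear_combination e0'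

theorem exists_conj_of_re_eq {g h : SU 2} (hre : (g.1 0 0).re = (h.1 0 0).re) :
    ∃ u : SU 2, g = u * h * u⁻¹ := by
  set a := (g.1 0 0).re with ha
  have h1 := re_apply_sq_le g
  have hz : (⟨a, √(1 - a ^ 2)⟩ : ℂ) * conj (⟨a, √(1 - a ^ 2)⟩ : ℂ) = 1 := by
    have := Real.sq_sqrt (sub_nonneg.2 h1)
    rw [Complex.mul_conj, Complex.normSq_apply]
    norm_cast
    simp only
    nlinarith
  obtain ⟨u, hu⟩ := exists_conj_diagonal g _ hz rfl
  obtain ⟨w, hw⟩ := exists_conj_diagonal h _ hz hre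
  refine ⟨u * w⁻¹, ?_⟩
  rw [hu, hw]
  group

/-- Every element of `SU(2)` is a balanced group commutator. -/
theorem exists_eq_commutator (g : SU 2) : ∃ V W : SU 2, g = V * W * V⁻¹ * W⁻¹ ∧
    opDist V 1 ^ 2 ≤ opDist g 1 ∧ opDist W 1 ^ 2 ≤ opDist g 1 := by
  have hg := opDist_one_sq g
  have hg0 := opDist_nonneg g 1
  have hg2 := opDist_le_two g 1
  -- With $s^2=t$ and $c^2=1-t$, take `V` diagonal with entries $c\pm is$ and `W` the real rotation
  -- with first column $(c,s)$. Their commutator has half-trace $1-2t^2$, the same as `g`, so it is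
  -- conjugate to `g`. Balance follows from $2-2c\le 2t$.
  set t := opDist g 1 / 2 with ht
  have ht0 : 0 ≤ t := by positivity
  have ht1 : t ≤ 1 := by linarith
  have hc2 : √(1 - t) ^ 2 = 1 - t := Real.sq_sqrt (by linarith)
  have hs2 : √t ^ 2 = t := Real.sq_sqrt ht0
  have hc0 := Real.sqrt_nonneg (1 - t)
  set c := √(1 - t)
  set s := √t
  have hct : 1 - t ≤ c := by nlinarith
  have hV : (⟨c, s⟩ : ℂ) * conj (⟨c, s⟩ : ℂ) + 0 * conj 0 = 1 := by
    rw [Complex.mul_conj, Complex.normSq_apply]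
    simp only [zero_mul, add_zero]
    norm_cast
    nlinarith
  have hW : (c : ℂ) * conj (c : ℂ) + (s : ℂ) * conj (s : ℂ) = 1 := by
    simp only [Complex.conj_ofReal]
    norm_cast
    nlinarith
  set V := ofColumn _ _ hV with hVdef
  set W := ofColumn _ _ hW with hWdef
  have hVd : opDist V 1 ^ 2 ≤ opDist g 1 := by
    rw [opDist_one_sq]
    simp only [hVdef, ofColumn, Matrix.of_apply, Matrix.cons_val_zero, Matrix.cons_val', Matrix.cons_val_fin_one]
    linarith
  have hWd : opDist W 1 ^ 2 ≤ opDist g 1 := by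
    rw [opDist_one_sq]
    simp only [hWdef, ofColumn, Matrix.of_apply, Matrix.cons_val_zero, Matrix.cons_val', Matrix.cons_val_fin_one, Complex.ofReal_re]
    linarith
  have hre : (g.1 0 0).re = ((V * W * V⁻¹ * W⁻¹).1 0 0).re := by
    have hM : (V * W * V⁻¹ * W⁻¹).1 = V.1 * W.1 * (V.1)ᴴ * (W.1)ᴴ := rfl
    rw [hM]
    simp only [Matrix.mul_apply, Fin.sum_univ_two, Matrix.conjTranspose_apply]
    simp [hVdef, hWdef, ofColumn]
    have : (g.1 0 0).re = 1 - 2 * t ^ 2 := by rw [ht]; linarith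
    rw [this]
    have e1 : s ^ 2 = t := hs2
    have e2 : c ^ 2 = 1 - t := hc2
    have e3 : (c * c * c + s * c * s) * c + (c * s * c - s * s * s) * s =
        (c ^ 2) ^ 2 + 2 * s ^ 2 * c ^ 2 - (s ^ 2) ^ 2 := by ring
    rw [e3, e1, e2]; ring
  obtain ⟨u, hu⟩ := exists_conj_of_re_eq hre
  have hconj : ∀ x : SU 2, opDist (u * x * u⁻¹) 1 = opDist x 1 := fun x => by
    rw [← opDist_mul_right u, ← opDist_mul_left u⁻¹]
    simp [mul_assoc]
  refine ⟨u * V * u⁻¹, u * W * u⁻¹, ?_, ?_, ?_⟩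
  · rw [hu]; group
  · rwa [hconj]
  · rwa [hconj]

/-- One Solovay-Kitaev step: the error $gg_0^{-1}$ of an approximation is a commutator of elements
at distance `s`, where $s^2$ is the current scale. Approximating these at scale $s^2$ perturbs the
commutator by only $O(s^3)$. Five approximations are used: four for the commutator and one for `g`.
-/
theorem exists_near_of_exists_near {ρ : SU 2 → ℝ} (hmul : ∀ g h, ρ (g * h) ≤ ρ g + ρ h)
    (hinv : ∀ g, ρ g⁻¹ = ρ g) {L x : ℝ} (hx : 0 ≤ x)
    (h : ∀ g, ∃ g', opDist g g' ≤ Real.exp (-x) / 64 ∧ ρ g' ≤ L) (g : SU 2) :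
    ∃ g', opDist g g' ≤ Real.exp (-(3 / 2 * x)) / 64 ∧ ρ g' ≤ 5 * L := by
  set s := Real.exp (-(x / 2)) / 8 with hs
  have hs0 : 0 < s := by positivity
  have hs1 : s ≤ 1 := by
    have : Real.exp (-(x / 2)) ≤ 1 := Real.exp_le_one_iff.2 (by linarith)
    rw [hs]; linarith
  have hr : Real.exp (-x) / 64 = s ^ 2 := by
    rw [hs, div_pow, ← Real.exp_nat_mul]; norm_num; ring
  have hr' : Real.exp (-(3 / 2 * x)) / 64 = 8 * s ^ 3 := by
    rw [hs, div_pow, ← Real.exp_nat_mul]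
    have : ((3 : ℕ) : ℝ) * -(x / 2) = -(3 / 2 * x) := by push_cast; ring
    rw [this]; ring
  rw [hr] at h
  rw [hr']
  obtain ⟨g₀, hg₀, hρ₀⟩ := h g
  obtain ⟨V, W, hc, hV, hW⟩ := exists_eq_commutator (g * g₀⁻¹)
  obtain ⟨V', hV', hρV⟩ := h V
  obtain ⟨W', hW', hρW⟩ := h W
  have hd : opDist (g * g₀⁻¹) 1 ≤ s ^ 2 := by
    rw [← opDist_mul_right g₀]; simpa using hg₀
  refine ⟨V' * W' * V'⁻¹ * W'⁻¹ * g₀, ?_, ?_⟩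
  · have hVs : opDist V 1 ≤ s := le_of_sq_le_sq (hV.trans hd) hs0.le
    have hWs : opDist W 1 ≤ s := le_of_sq_le_sq (hW.trans hd) hs0.le
    have := opDist_commutator_le hVs hWs hV' hW' (hc ▸ hd)
    rw [← opDist_mul_right g₀⁻¹, mul_inv_cancel_right, hc]
    refine this.trans ?_
    have : s ^ 4 ≤ s ^ 3 := pow_le_pow_of_le_one hs0.le hs1 (by norm_num)
    nlinarith
  · have h1 := hmul (V' * W' * V'⁻¹ * W'⁻¹) g₀
    have h2 := hmul (V' * W' * V'⁻¹) W'⁻¹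
    have h3 := hmul (V' * W') V'⁻¹
    have h4 := hmul V' W'
    rw [hinv] at h2 h3
    linarith

/-- The Solovay-Kitaev theorem, for an arbitrary length function on `SU(2)`. -/
theorem exists_near_iterate {ρ : SU 2 → ℝ} (hmul : ∀ g h, ρ (g * h) ≤ ρ g + ρ h)
    (hinv : ∀ g, ρ g⁻¹ = ρ g) {L : ℝ} (h : ∀ g, ∃ g', opDist g g' ≤ 1 / 128 ∧ ρ g' ≤ L) (k : ℕ)
    (g : SU 2) : ∃ g', opDist g g' ≤ Real.exp (-(Real.log 2 * (3 / 2) ^ k)) ∧ ρ g' ≤ 5 ^ k * L := by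
  have h2 : 0 < Real.log 2 := Real.log_pos (by norm_num)
  have key : ∀ g, ∃ g', opDist g g' ≤ Real.exp (-(Real.log 2 * (3 / 2) ^ k)) / 64 ∧
      ρ g' ≤ 5 ^ k * L := by
    induction k with
    | zero =>
      intro g
      obtain ⟨g', h1, h3⟩ := h g
      refine ⟨g', h1.trans (le_of_eq ?_), by simpa using h3⟩
      -- The initial scale 1/128 is $e^{-x}/64$ with $x=\log 2$.
      rw [pow_zero, mul_one, Real.exp_neg, Real.exp_log (by norm_num)]
      norm_num
    | succ k ih =>
      intro g
      obtain ⟨g', h1, h3⟩ := exists_near_of_exists_near hmul hinv (by positivity) ih g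
      refine ⟨g', h1.trans (le_of_eq ?_), h3.trans (le_of_eq (by ring))⟩
      congr 3; ring
  obtain ⟨g', h1, h3⟩ := key g
  exact ⟨g', h1.trans (div_le_self (Real.exp_nonneg _) (by norm_num)), h3⟩

/-- The Lipschitz bound at the identity pays for the remainder $gg'^{-1}$, so finitely many
refinements bound the length of `g` itself. -/
theorem length_le_of_exists_near {ρ : SU 2 → ℝ} (hmul : ∀ g h, ρ (g * h) ≤ ρ g + ρ h)
    (hinv : ∀ g, ρ g⁻¹ = ρ g) {L : ℝ} (hlip : ∀ g, ρ g ≤ opDist g 1)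
    (h : ∀ g, ∃ g', opDist g g' ≤ 1 / 128 ∧ ρ g' ≤ L) (k : ℕ) (g : SU 2) :
    ρ g ≤ 5 ^ k * L + Real.exp (-(Real.log 2 * (3 / 2) ^ k)) := by
  obtain ⟨g', h1, h2⟩ := exists_near_iterate hmul hinv h k g
  have h3 := hmul (g * g'⁻¹) g'
  have h4 := hlip (g * g'⁻¹)
  rw [← opDist_mul_right g'] at h4
  simp only [inv_mul_cancel_right, one_mul] at h3 h4
  linarith

end SU

/-! ### Givens rotations: from $SU(2)$ to $SU(d)$ -/

namespace SU

section givens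

variable {d : ℕ}

theorem conjTranspose_pairIncl_mulVec (i j : Fin d) (v : Fin d → ℂ) :
    (pairIncl i j)ᴴ *ᵥ v = ![v i, v j] := by
  have h : ∀ k, ((pairIncl i j)ᴴ *ᵥ v) k = v (![i, j] k) := by
    intro k
    simp only [Matrix.mulVec, dotProduct, pairIncl, Matrix.conjTranspose_apply, Matrix.of_apply]
    rw [Finset.sum_eq_single (![i, j] k)]
    · simp
    · intro b _ hb
      simp [hb]
    · simp
  ext k
  rw [h]
  fin_cases k <;> rfl

theorem pairIncl_mulVec (i j : Fin d) (w : Fin 2 → ℂ) (a : Fin d) :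
    (pairIncl i j *ᵥ w) a = (if a = i then w 0 else 0) + (if a = j then w 1 else 0) := by
  simp [pairIncl, Matrix.mulVec, dotProduct, Fin.sum_univ_two]
  congr

theorem embedMatrix_mulVec (i j : Fin d) (γ : Matrix (Fin 2) (Fin 2) ℂ) (v : Fin d → ℂ)
    (a : Fin d) : (embedMatrix i j γ *ᵥ v) a =
      v a + ((if a = i then (γ 0 0 - 1) * v i + γ 0 1 * v j else 0) +
        (if a = j then γ 1 0 * v i + (γ 1 1 - 1) * v j else 0)) := by
  rw [embedMatrix, Matrix.add_mulVec, ← Matrix.mulVec_mulVec, ← Matrix.mulVec_mulVec,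
    conjTranspose_pairIncl_mulVec, Pi.add_apply, pairIncl_mulVec, Matrix.one_mulVec]
  simp [Matrix.mulVec, dotProduct, Fin.sum_univ_two]

/-- A vector of `ℂ²` can be rotated by `SU(2)` to a nonnegative multiple of the first basis
vector. -/
theorem exists_rotation (x y : ℂ) : ∃ (γ : SU 2) (r : ℝ), 0 ≤ r ∧
    γ.1 0 0 * x + γ.1 0 1 * y = r ∧ γ.1 1 0 * x + γ.1 1 1 * y = 0 := by
  set n : ℝ := √(Complex.normSq x + Complex.normSq y) with hn
  have hpos : 0 ≤ Complex.normSq x + Complex.normSq y :=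
    add_nonneg (Complex.normSq_nonneg _) (Complex.normSq_nonneg _)
  rcases hpos.eq_or_lt with h0 | h0
  · have hx : x = 0 := Complex.normSq_eq_zero.1
      (by linarith [Complex.normSq_nonneg x, Complex.normSq_nonneg y])
    have hy : y = 0 := Complex.normSq_eq_zero.1
      (by linarith [Complex.normSq_nonneg x, Complex.normSq_nonneg y])
    exact ⟨1, 0, le_rfl, by simp [hx, hy], by simp [hx, hy]⟩
  have hn0 : (n : ℂ) ≠ 0 := by exact_mod_cast (Real.sqrt_pos.2 h0).ne'
  have hn2 : (n : ℂ) ^ 2 = x * starRingEnd ℂ x + y * starRingEnd ℂ y := by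
    rw [Complex.mul_conj, Complex.mul_conj]
    exact_mod_cast Real.sq_sqrt hpos
  refine ⟨ofColumn (starRingEnd ℂ x / n) (-y / n) ?_, n, Real.sqrt_nonneg _, ?_, ?_⟩
  · simp only [map_div₀, Complex.conj_ofReal, map_neg, Complex.conj_conj]
    field_simp
    rw [hn2]; ring
  · simp [ofColumn]
    field_simp
    rw [hn2]; ring
  · simp [ofColumn]
    field_simp
    ring

theorem val_add_one [d.AtLeastTwo] {i : Fin d} (h : i.val + 1 < d) : (i + 1).val = i.val + 1 := by
  rw [Fin.val_add_eq_ite]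
  have : (1 : Fin d).val = 1 := by
    rw [Fin.val_one', Nat.mod_eq_of_lt]; omega
  rw [this, if_neg (by omega)]

theorem column_inner {g : SU d} (c k : Fin d) :
    ∑ a, starRingEnd ℂ (g.1 a c) * g.1 a k = if c = k then 1 else 0 := by
  have h := Matrix.mem_unitaryGroup_iff'.1 (Matrix.mem_specialUnitaryGroup_iff.1 g.2).1
  have := congrFun (congrFun h c) k
  simpa [Matrix.mul_apply, Matrix.star_apply, Matrix.one_apply] using this

variable [d.AtLeastTwo] {ρ : SU d → ℝ} {R : ℝ}

/-- Adjacent rotations clear the entries of a vector below a given one. -/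
theorem exists_clear (hmul : ∀ g h, ρ (g * h) ≤ ρ g + ρ h)
    (hR : ∀ i γ, ρ (embed (ne_add_one i) γ) ≤ R) (k : Fin d) (n : ℕ) (hn : k.val + n < d)
    (v : Fin d → ℂ) (hv : ∀ a : Fin d, k.val + n < a.val → v a = 0)
    (h0 : n = 0 → ∃ r : ℝ, 0 ≤ r ∧ v k = r) :
    ∃ h : SU d, ρ h ≤ (n + 1) * R ∧ (∀ a, k < a → (h.1 *ᵥ v) a = 0) ∧
      (∀ a, a < k → (h.1 *ᵥ v) a = v a) ∧ (∃ r : ℝ, 0 ≤ r ∧ (h.1 *ᵥ v) k = r) ∧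
      ∀ w : Fin d → ℂ, (∀ a, k ≤ a → w a = 0) → h.1 *ᵥ w = w := by
  induction n generalizing v with
  | zero =>
    -- No rotation is made, but an abstract length need not vanish at 1; it is charged `R`, which is
    -- the extra one in `n + 1`.
    refine ⟨1, ?_, ?_, ?_, ?_, ?_⟩
    · have := hR k 1
      rw [embed_one] at this
      simpa using this
    · intro a ha; simpa using hv a ha
    · intro a _; simp
    · simpa using h0 rfl
    · intro w _; simp
  | succ n ih =>
    set i : Fin d := ⟨k.val + n, by omega⟩ with hi
    have hi1 : (i + 1).val = k.val + n + 1 := val_add_one (i := i) hn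
    obtain ⟨γ, r, hr, hγ0, hγ1⟩ := exists_rotation (v i) (v (i + 1))
    have hval : ∀ w a, ((embed (ne_add_one i) γ).1 *ᵥ w) a = _ :=
      fun w a => embedMatrix_mulVec i (i + 1) γ.1 w a
    set v' := (embed (ne_add_one i) γ).1 *ᵥ v with hv'
    have hvi : v' i = r := by
      rw [hv', hval, if_pos rfl, if_neg (ne_add_one i)]
      linear_combination hγ0
    have hvi1 : v' (i + 1) = 0 := by
      rw [hv', hval, if_pos rfl, if_neg (ne_add_one i).symm]
      linear_combination hγ1
    have hother : ∀ w a, a ≠ i → a ≠ i + 1 → ((embed (ne_add_one i) γ).1 *ᵥ w) a = w a := by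
      intro w a h1 h2
      rw [hval, if_neg h1, if_neg h2]; ring
    obtain ⟨h, hρ, h1, h2, h3, h4⟩ := ih (by omega) v' (by
      intro a ha
      by_cases hai : a = i + 1
      · rw [hai, hvi1]
      · have hai' : a.val ≠ k.val + n + 1 := fun h => hai (Fin.ext (h.trans hi1.symm))
        rw [hv', hother v a (fun h => by rw [h, hi] at ha; simp at ha) hai]
        exact hv a (by omega)) (by
      rintro rfl
      exact ⟨r, hr, hvi⟩)
    refine ⟨h * embed (ne_add_one i) γ, ?_, ?_, ?_, ?_, ?_⟩
    · have := hmul h (embed (ne_add_one i) γ)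
      have := hR i γ
      push_cast
      linarith
    · intro a ha
      rw [coe_mul, ← Matrix.mulVec_mulVec]; exact h1 a ha
    · intro a ha
      rw [coe_mul, ← Matrix.mulVec_mulVec, h2 a ha]
      have ha' : a.val < k.val := ha
      refine hother v a (fun h => ?_) (fun h => ?_)
      · rw [h] at ha'; simp [hi] at ha'
      · rw [h, hi1] at ha'; omega
    · rw [coe_mul, ← Matrix.mulVec_mulVec]; exact h3
    · intro w hw
      have e : (embed (ne_add_one i) γ).1 *ᵥ w = w := by
        have w1 : w i = 0 := hw i (by rw [Fin.le_def]; simp [hi])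
        have w2 : w (i + 1) = 0 := hw (i + 1) (by rw [Fin.le_def, hi1]; omega)
        ext a
        rw [hval, w1, w2]; simp
      rw [coe_mul, ← Matrix.mulVec_mulVec, e, h4 w hw]

/-- `SU(d)` is generated in `d ^ 2` steps by the copies of `SU(2)` acting on adjacent
coordinates. -/
theorem length_le_of_embed_le (hmul : ∀ g h, ρ (g * h) ≤ ρ g + ρ h) (hinv : ∀ g, ρ g⁻¹ = ρ g)
    (hR : ∀ i γ, ρ (embed (ne_add_one i) γ) ≤ R) (g : SU d) : ρ g ≤ (d : ℝ) ^ 2 * R := by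
  have hd : 2 ≤ d := Nat.AtLeastTwo.prop
  have h1R : ρ 1 ≤ R := by
    have := hR 0 1
    rwa [embed_one] at this
  have hR0 : 0 ≤ R := by
    have := hmul 1 1
    rw [mul_one] at this
    linarith
  have hzero : ∀ (g : SU d) (c k : Fin d), c ≠ k → (∀ a, g.1 a c = if a = c then 1 else 0) →
      g.1 c k = 0 := by
    intro g c k hck hc
    have := column_inner (g := g) c k
    simp_rw [hc, if_neg hck] at this
    simpa using this
  -- The first `k` columns are already standard. Clearing the next one costs at most `d * R`;
  -- unitarity kills its entries above the diagonal, and a nonnegative diagonal entry of modulus one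
  -- is 1. The last column is free, being fixed by unitarity and the determinant.
  have key : ∀ (m k : ℕ), k + m + 1 = d → ∀ g : SU d,
      (∀ c : Fin d, c.val < k → ∀ a, g.1 a c = if a = c then 1 else 0) →
      ρ g ≤ (m * d + 1) * R := by
    intro m
    induction m with
    | zero =>
      intro k hk g hg
      have hdiag : g.1 = Matrix.diagonal fun c => g.1 c c := by
        ext a c
        by_cases hc : c.val < k
        · rw [hg c hc, Matrix.diagonal_apply]
          split_ifs with h
          · rw [h, hg c hc, if_pos rfl]
          · rfl
        · rw [Matrix.diagonal_apply]
          split_ifs with h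
          · rw [h]
          · have ha : a.val < k := by
              have := a.2; have := c.2
              have : a.val ≠ c.val := fun h' => h (Fin.ext h')
              omega
            exact hzero g a c h (hg a ha)
      have hlast : ∀ c, g.1 c c = 1 := by
        have hdet := (Matrix.mem_specialUnitaryGroup_iff.1 g.2).2
        rw [hdiag, Matrix.det_diagonal] at hdet
        intro c
        by_cases hc : c.val < k
        · rw [hg c hc, if_pos rfl]
        · rw [Finset.prod_eq_single c (fun b _ hb => ?_) (by simp)] at hdet
          · exact hdet
          · have hb' : b.val < k := by
              have := b.2; have := c.2
              have : b.val ≠ c.val := fun h' => hb (Fin.ext h')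
              omega
            rw [hg b hb', if_pos rfl]
      have : g = 1 := by
        refine Subtype.ext ?_
        rw [hdiag]
        simp_rw [hlast]
        exact Matrix.diagonal_one
      rw [this]
      simpa using h1R
    | succ m ih =>
      intro k hk g hg
      set κ : Fin d := ⟨k, by omega⟩ with hκ
      obtain ⟨h, hρ, h1, h2, ⟨r, hr, h3⟩, h4⟩ := exists_clear hmul hR κ (m + 1)
        (by simp [hκ]; omega) (fun a => g.1 a κ) (fun a ha => by
          have := a.2; simp [hκ] at ha; omega) (by simp)
      have hcol : ∀ c a, (h * g).1 a c = (h.1 *ᵥ fun b => g.1 b c) a := fun c a => rfl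
      have hlow : ∀ c : Fin d, c.val < k → ∀ a, (h * g).1 a c = if a = c then 1 else 0 := by
        intro c hc a
        rw [hcol, h4]
        · exact hg c hc a
        · intro b hb
          have : b ≠ c := by
            rintro rfl
            exact absurd hc (not_lt.2 (Fin.le_def.1 hb))
          rw [hg c hc, if_neg this]
      have hκcol : ∀ a, a ≠ κ → (h * g).1 a κ = 0 := by
        intro a ha
        rcases lt_or_gt_of_ne ha with h' | h'
        · exact hzero _ a κ ha (hlow a h')
        · exact h1 a h'
      have hκκ : (h * g).1 κ κ = 1 := by
        have h5 := column_inner (g := h * g) κ κ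
        rw [Finset.sum_eq_single κ (fun b _ hb => by rw [hκcol b hb, mul_zero]) (by simp),
          if_pos rfl] at h5
        have h6 : (h * g).1 κ κ = r := h3
        rw [h6, Complex.conj_ofReal] at h5
        have h7 : r * r = 1 := by exact_mod_cast h5
        have h8 : r = 1 := by nlinarith
        rw [h6, h8, Complex.ofReal_one]
      have hfin := ih (k + 1) (by omega) (h * g) (by
        intro c hc a
        by_cases hck : c.val < k
        · exact hlow c hck a
        · have : c = κ := Fin.ext (by simp [hκ]; omega)
          rw [this]
          split_ifs with ha
          · rw [ha, hκκ]
          · exact hκcol a ha)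
      have h9 := hmul h⁻¹ (h * g)
      rw [inv_mul_cancel_left, hinv] at h9
      have hmd : ((m + 1 : ℕ) : ℝ) + 1 ≤ d := by exact_mod_cast (by omega : m + 1 + 1 ≤ d)
      have := mul_le_mul_of_nonneg_right hmd hR0
      push_cast at *
      nlinarith
  have := key (d - 1) 0 (by omega) g (by simp)
  refine this.trans (mul_le_mul_of_nonneg_right ?_ hR0)
  rw [Nat.cast_sub (by omega)]
  have : (2 : ℝ) ≤ d := by exact_mod_cast hd
  push_cast
  nlinarith

end givens

end SU

/-! ### Volume of balls in $SU(d)$ -/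

namespace SU

section volume

variable {d : ℕ}

open scoped Matrix.Norms.L2Operator in
theorem norm_single_le (a b : Fin d) (x : ℂ) : ‖Matrix.single a b x‖ ≤ ‖x‖ := by
  have h := Matrix.l2_opNorm_conjTranspose_mul_self (Matrix.single a b x)
  rw [Matrix.conjTranspose_single, Matrix.single_mul_single_same,
    ← Matrix.diagonal_single, Matrix.l2_opNorm_diagonal, Pi.norm_single, norm_mul] at h
  simp only [norm_star] at h
  nlinarith [norm_nonneg x, norm_nonneg (Matrix.single a b x)]

open scoped Matrix.Norms.L2Operator in
theorem opDist_le_of_entries {g h : SU d} {r : ℝ} (hr : ∀ a b, ‖g.1 a b - h.1 a b‖ ≤ r) :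
    opDist g h ≤ (d : ℝ) ^ 2 * r := by
  rw [opDist_eq_norm, Matrix.matrix_eq_sum_single (g.1 - h.1)]
  refine (norm_sum_le Finset.univ
    fun a => ∑ b, Matrix.single a b ((g.1 - h.1) a b)).trans ?_
  calc _ ≤ ∑ _a : Fin d, ∑ _b : Fin d, r := Finset.sum_le_sum fun a _ =>
        (norm_sum_le _ _).trans (Finset.sum_le_sum fun b _ => (norm_single_le a b _).trans (hr a b))
    _ = _ := by simp; ring

instance instIsMulLeftInvariantHaar : (haar d).IsMulLeftInvariant :=
  inferInstanceAs (Measure.haarMeasure _).IsMulLeftInvariant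

instance instIsHaarMeasureHaar : (haar d).IsHaarMeasure :=
  inferInstanceAs (Measure.haarMeasure _).IsHaarMeasure

theorem haar_ball (x : SU d) (r : ℝ) :
    (haar d).real {g | opDist x g ≤ r} = (haar d).real {g | opDist 1 g ≤ r} := by
  have : {g : SU d | opDist 1 g ≤ r} = (fun g => x * g) ⁻¹' {g | opDist x g ≤ r} := by
    ext g
    simp only [Set.mem_ofPred_eq, Set.mem_preimage]
    rw [← opDist_mul_left x, mul_one]
  rw [this, measureReal_def, measureReal_def, measure_preimage_mul]

/-- A lower bound for the volume of a ball, from a grid covering. -/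
theorem le_haar_ball (hd : 1 ≤ d) {r : ℝ} (hr : 0 < r) (hr1 : r ≤ 1) (x : SU d) :
    (r / (7 * (d : ℝ) ^ 2)) ^ (2 * d ^ 2) ≤ (haar d).real {g | opDist x g ≤ r} := by
  have hd' : (1 : ℝ) ≤ (d : ℝ) ^ 2 := one_le_pow₀ (by exact_mod_cast hd)
  -- Real and imaginary parts of the entries are rounded to a grid of mesh `1 / M`. Matrices in the
  -- same cell differ by at most `2 / M` per entry, hence by $2d^2/M\le r$ in norm.
  set M : ℕ := ⌈2 * (d : ℝ) ^ 2 / r⌉₊ with hM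
  have hM1 : 2 * (d : ℝ) ^ 2 / r ≤ M := Nat.le_ceil _
  have hM2 : (M : ℝ) < 2 * (d : ℝ) ^ 2 / r + 1 := Nat.ceil_lt_add_one (by positivity)
  have hM0 : (0 : ℝ) < M := lt_of_lt_of_le (by positivity) hM1
  have hfl : ∀ t : ℝ, |t| ≤ 1 → ⌊M * t⌋ ∈ Finset.Icc (-(M : ℤ)) M := by
    intro t ht
    rw [abs_le] at ht
    rw [Finset.mem_Icc]
    constructor
    · rw [Int.le_floor]; push_cast; nlinarith
    · have : ((⌊M * t⌋ : ℤ) : ℝ) ≤ M := (Int.floor_le _).trans (by nlinarith)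
      exact_mod_cast this
  have hentry : ∀ (g : SU d) a b, ‖g.1 a b‖ ≤ 1 := fun g a b =>
    entry_norm_bound_of_unitary (Matrix.mem_specialUnitaryGroup_iff.1 g.2).1 a b
  let I := Finset.Icc (-(M : ℤ)) M
  let φ : SU d → (Fin d → Fin d → I × I) := fun g a b =>
    (⟨⌊M * (g.1 a b).re⌋, hfl _ ((Complex.abs_re_le_norm _).trans (hentry g a b))⟩,
      ⟨⌊M * (g.1 a b).im⌋, hfl _ ((Complex.abs_im_le_norm _).trans (hentry g a b))⟩)
  have hfl2 : ∀ s t : ℝ, ⌊M * s⌋ = ⌊M * t⌋ → |s - t| ≤ 1 / M := by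
    intro s t h
    have := Int.abs_sub_lt_one_of_floor_eq_floor h
    rw [← mul_sub, abs_mul, abs_of_pos hM0] at this
    rw [le_div_iff₀ hM0, mul_comm]
    exact this.le
  have hφ : ∀ g h, φ g = φ h → opDist g h ≤ r := by
    intro g h hgh
    have : ∀ a b, ‖g.1 a b - h.1 a b‖ ≤ 2 / M := by
      intro a b
      have h1 := congrFun (congrFun hgh a) b
      simp only [φ, Prod.mk.injEq, Subtype.mk.injEq] at h1
      refine (Complex.norm_le_abs_re_add_abs_im _).trans ?_
      have h2 := hfl2 _ _ h1.1
      have h3 := hfl2 _ _ h1.2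
      rw [Complex.sub_re, Complex.sub_im]
      calc _ ≤ 1 / (M : ℝ) + 1 / M := add_le_add h2 h3
        _ = _ := by ring
    refine (opDist_le_of_entries this).trans ?_
    rw [div_le_iff₀ hr] at hM1
    rw [mul_div_assoc', div_le_iff₀ hM0]
    linarith
  -- One representative per occupied cell; the values at empty cells are arbitrary and harmless.
  let s : (Fin d → Fin d → I × I) → SU d := Function.invFun φ
  have hcover : (Set.univ : Set (SU d)) ⊆ ⋃ c, {g | opDist (s c) g ≤ r} := by
    intro g _
    refine Set.mem_iUnion.2 ⟨φ g, ?_⟩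
    exact hφ _ _ (Function.invFun_eq ⟨g, rfl⟩)
  have hcard : (Fintype.card (Fin d → Fin d → I × I) : ℝ) = (2 * M + 1) ^ (2 * d ^ 2) := by
    have hI : Fintype.card I = 2 * M + 1 := by
      rw [Fintype.card_coe, Int.card_Icc]; omega
    simp only [Fintype.card_fun, Fintype.card_prod, Fintype.card_fin, hI]
    push_cast
    rw [← sq, ← pow_mul, ← pow_mul]
    congr 1; ring
  have h1 : 1 ≤ (2 * (M : ℝ) + 1) ^ (2 * d ^ 2) * (haar d).real {g | opDist x g ≤ r} := by
    calc (1 : ℝ) = (haar d).real Set.univ := by simp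
      _ ≤ (haar d).real (⋃ c, {g | opDist (s c) g ≤ r}) := measureReal_mono hcover
      _ ≤ ∑ c, (haar d).real {g | opDist (s c) g ≤ r} := measureReal_iUnion_fintype_le _
      _ = _ := by
        simp_rw [haar_ball _ r]
        rw [Finset.sum_const, nsmul_eq_mul, Finset.card_univ, hcard]
  -- The 7 comes from $r(2M+1)\le 4d^2+3r\le 7d^2$.
  have h2 : r / (7 * (d : ℝ) ^ 2) * (2 * M + 1) ≤ 1 := by
    rw [div_mul_eq_mul_div, div_le_one (by positivity)]
    have : r * M ≤ 2 * (d : ℝ) ^ 2 + r := by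
      have := mul_lt_mul_of_pos_left hM2 hr
      rw [mul_add, mul_div_cancel₀ _ hr.ne', mul_one] at this
      exact this.le
    nlinarith
  have h3 : (r / (7 * (d : ℝ) ^ 2)) ^ (2 * d ^ 2) * (2 * M + 1) ^ (2 * d ^ 2) ≤ 1 := by
    rw [← mul_pow]
    exact pow_le_one₀ (by positivity) h2
  have h4 : 0 ≤ (haar d).real {g : SU d | opDist x g ≤ r} := measureReal_nonneg
  calc (r / (7 * (d : ℝ) ^ 2)) ^ (2 * d ^ 2)
      ≤ (r / (7 * (d : ℝ) ^ 2)) ^ (2 * d ^ 2) *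
        ((2 * (M : ℝ) + 1) ^ (2 * d ^ 2) * (haar d).real {g | opDist x g ≤ r}) :=
        le_mul_of_one_le_right (by positivity) h1
    _ = ((r / (7 * (d : ℝ) ^ 2)) ^ (2 * d ^ 2) * (2 * M + 1) ^ (2 * d ^ 2)) *
        (haar d).real {g | opDist x g ≤ r} := by ring
    _ ≤ _ := mul_le_of_le_one_left h4 h3

end volume

end SU

/-- `H` is normal, and all of `K` has a single image in `G ⧸ H`, whose powers are dense; so the
quotient is abelian. In a compact group the submonoid generated by `K` is already dense, so
conjugation by inverses of elements of `K` is not needed. -/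
theorem Subgroup.commutator_mem_of_dense {G : Type*} [Group G] [TopologicalSpace G]
    [IsTopologicalGroup G] [CompactSpace G] {H : Subgroup G} (hH : IsClosed (H : Set G)) {K : Set G}
    (hK : Dense (Subgroup.closure K : Set G)) (hdiff : ∀ x ∈ K, ∀ y ∈ K, x * y⁻¹ ∈ H)
    (hconj : ∀ x ∈ K, ∀ h ∈ H, x * h * x⁻¹ ∈ H) (x y : G) : x * y * x⁻¹ * y⁻¹ ∈ H := by
  have hK' : Dense (Submonoid.closure K : Set G) := dense_submonoidClosure_iff_subgroupClosure.2 hK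
  have of_dense : ∀ {s : Set G}, IsClosed s → (∀ x ∈ Submonoid.closure K, x ∈ s) → ∀ x, x ∈ s :=
    fun {s} hs h x => hs.closure_subset_iff.2 h (hK'.closure_eq ▸ Set.mem_univ x)
  have hnormal : H.Normal := by
    refine ⟨fun h hh x => ?_⟩
    refine of_dense (s := {x | x * h * x⁻¹ ∈ H}) (hH.preimage (by fun_prop)) (fun x hx => ?_) x
    have : ∀ h ∈ H, x * h * x⁻¹ ∈ H := by
      induction hx using Submonoid.closure_induction with
      | mem x hx => exact hconj x hx
      | one => intro h hh; simpa using hh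
      | mul x y _ _ hx hy =>
        intro h hh
        have e : x * y * h * (x * y)⁻¹ = x * (y * h * y⁻¹) * x⁻¹ := by group
        rw [e]; exact hx _ (hy h hh)
    exact this h hh
  have hiff : ∀ x y : G, x * y * x⁻¹ * y⁻¹ ∈ H ↔ Commute (x : G ⧸ H) (y : G ⧸ H) := by
    intro x y
    rw [← QuotientGroup.eq_one_iff, QuotientGroup.mk_mul, QuotientGroup.mk_mul,
      QuotientGroup.mk_mul, QuotientGroup.mk_inv, QuotientGroup.mk_inv, mul_inv_eq_one,
      mul_inv_eq_iff_eq_mul]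
    rfl
  have hstep : ∀ k ∈ K, ∀ x, x * k * x⁻¹ * k⁻¹ ∈ H := by
    intro k hk x
    refine of_dense (s := {x | x * k * x⁻¹ * k⁻¹ ∈ H}) (hH.preimage (by fun_prop))
      (fun x hx => ?_) x
    rw [Set.mem_ofPred_eq, hiff]
    induction hx using Submonoid.closure_induction with
    | mem x hx =>
      have h : (x : G ⧸ H) = k := by
        have := hdiff x hx k hk
        rwa [← QuotientGroup.eq_one_iff, QuotientGroup.mk_mul, QuotientGroup.mk_inv,
          mul_inv_eq_one] at this
      rw [h]
    | one => exact Commute.one_left _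
    | mul x y _ _ hx hy => exact hx.mul_left hy
  refine of_dense (s := {y | x * y * x⁻¹ * y⁻¹ ∈ H}) (hH.preimage (by fun_prop))
    (fun y hy => ?_) y
  rw [Set.mem_ofPred_eq, hiff]
  induction hy using Submonoid.closure_induction with
  | mem k hk => exact (hiff x k).1 (hstep k hk x)
  | one => exact Commute.one_right _
  | mul y z _ _ hy hz => exact hy.mul_right hz

/-! ### Controlled points of $SU(2)$ -/

namespace SU

open CompactWalk

variable (η : Measure (SU 2)) [IsProbabilityMeasure η]

/-- Each coordinate pair carries weight $1/d$ in the step measure; this is where powers of `d` enter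
the control. -/
theorem integral_map_embed_le (d : ℕ) [d.AtLeastTwo] (i : Fin d) {F : SU d → ℝ}
    (hF : Continuous F) (hF0 : ∀ g, 0 ≤ F g) :
    ∫ γ, F (embed (ne_add_one i) γ) ∂η ≤ d * ∫ g, F g ∂(stepMeasure η d) := by
  have hd : (d : ℝ) ≠ 0 := by exact_mod_cast NeZero.ne d
  have hmeas : ∀ j : Fin d, Measurable (embed (ne_add_one j)) := fun j =>
    (continuous_embed _).measurable
  have hint : ∀ j : Fin d, Integrable F (η.map (embed (ne_add_one j))) := fun j => by
    have := Measure.isProbabilityMeasure_map (μ := η) (hmeas j).aemeasurable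
    exact integrable_continuousMap _ ⟨F, hF⟩
  rw [stepMeasure, integral_smul_measure, integral_finsetSum_measure fun j _ => hint j]
  simp only [ENNReal.toReal_inv, ENNReal.toReal_natCast, smul_eq_mul]
  rw [mul_inv_cancel_left₀ hd, ← integral_map (hmeas i).aemeasurable hF.aestronglyMeasurable]
  exact Finset.single_le_sum (f := fun j => ∫ g, F g ∂(η.map (embed (ne_add_one j))))
    (fun j _ => integral_nonneg hF0) (Finset.mem_univ i)

/-- Near a point of the support of `η`, some translate of `f` is close to the image of `f` under the transition operator. -/
theorem exists_translate_near_transition {k : SU 2} (hk : k ∈ η.support) {r : ℝ} (hr : 0 < r) :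
    ∃ C : ℝ, 0 ≤ C ∧ ∀ (d : ℕ) [d.AtLeastTwo] (i : Fin d) (f : C(SU d, ℝ)),
      ∃ k' : SU 2, opDist k k' ≤ r ∧
        l2 (haar d) (translate (embed (ne_add_one i) k') f - transition (stepMeasure η d) f) ≤
          C * d * energyLoss (stepMeasure η d) (haar d) 1 f := by
  set U := {h | opDist k h < r} with hU
  have hUpos : 0 < η U := Measure.mem_support_iff_forall k |>.1 hk U (opDist_lt_mem_nhds k hr)
  have hp : 0 < η.real U := ENNReal.toReal_pos hUpos.ne' (measure_ne_top _ _)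
  -- The constant sees only the mass that `η` gives to a ball around `k`, hence is independent of
  -- `d`.
  refine ⟨1 / √(η.real U), by positivity, fun d _ i f => ?_⟩
  have hd : (1 : ℝ) ≤ d := by exact_mod_cast NeZero.one_le
  set φ : SU d → ℝ := fun g => l2 (haar d) (translate g f - transition (stepMeasure η d) f) ^ 2
  have hφ : Continuous φ := (continuous_l2_translate_sub (haar d) f _).pow 2
  have hφ' : Continuous fun γ => φ (embed (ne_add_one i) γ) := hφ.comp (continuous_embed _)
  have hint : Integrable (fun γ => φ (embed (ne_add_one i) γ)) η :=
    integrable_continuousMap η ⟨_, hφ'⟩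
  have hφ0 : ∀ g, 0 ≤ φ g := fun g => sq_nonneg _
  obtain ⟨k', hk', hle⟩ := exists_le_setAverage hUpos.ne' (measure_ne_top _ _) hint.integrableOn
  refine ⟨k', le_of_lt hk', ?_⟩
  set E := energyLoss (stepMeasure η d) (haar d) 1 f with hE
  have hE0 : 0 ≤ E := energyLoss_nonneg _ _ _ _
  have hφint : ∫ g, φ g ∂(stepMeasure η d) = E ^ 2 := by
    rw [hE, energyLoss_sq]
    exact integral_l2_translate_sub_transition _ _ _
  refine le_of_sq_le_sq ?_ (by positivity)
  rw [setAverage_eq, smul_eq_mul] at hle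
  have h1 : ∫ γ in U, φ (embed (ne_add_one i) γ) ∂η ≤ d * E ^ 2 := by
    rw [← hφint]
    exact (setIntegral_le_integral hint (.of_forall fun γ => hφ0 _)).trans
      (integral_map_embed_le η d i hφ hφ0)
  calc _ ≤ (η.real U)⁻¹ * (d * E ^ 2) :=
        hle.trans (mul_le_mul_of_nonneg_left h1 (by positivity))
    -- Enlarging `d` to `d ^ 2` keeps the final bound free of square roots of `d`.
    _ ≤ (η.real U)⁻¹ * (d ^ 2 * E ^ 2) := by
        refine mul_le_mul_of_nonneg_left (mul_le_mul_of_nonneg_right ?_ (sq_nonneg _))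
          (by positivity)
        nlinarith
    _ = _ := by rw [mul_pow, mul_pow, div_pow, Real.sq_sqrt hp.le]; ring

/-- The bound `C d ^ m` times the energy loss controls the displacement of some point `r`-close
to `g`, uniformly over all the embeddings of `SU(2)`. -/
def IsControlled (g : SU 2) (r : ℝ) (m : ℕ) (C : ℝ) : Prop :=
  ∀ (d : ℕ) [d.AtLeastTwo] (i : Fin d) (f : C(SU d, ℝ)), ∃ g' : SU 2, opDist g g' ≤ r ∧
    displacement (haar d) f (embed (ne_add_one i) g') ≤
      C * d ^ m * energyLoss (stepMeasure η d) (haar d) m f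

variable {η}

theorem mul_pow_mul_energyLoss_mono (d : ℕ) [d.AtLeastTwo] (f : C(SU d, ℝ)) {m n : ℕ}
    (hmn : m ≤ n) {C D : ℝ} (hC : 0 ≤ C) (hCD : C ≤ D) :
    C * d ^ m * energyLoss (stepMeasure η d) (haar d) m f ≤
      D * d ^ n * energyLoss (stepMeasure η d) (haar d) n f := by
  have hd : (1 : ℝ) ≤ d := by exact_mod_cast NeZero.one_le
  have h1 := energyLoss_mono (stepMeasure η d) (haar d) hmn f
  have h2 := energyLoss_nonneg (stepMeasure η d) (haar d) m f
  have h3 := pow_le_pow_right₀ hd hmn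
  have : 0 ≤ D := hC.trans hCD
  gcongr

theorem IsControlled.mono {g h : SU 2} {r s : ℝ} {m n : ℕ} {C D : ℝ}
    (hg : IsControlled η g r m C) (hs : opDist h g + r ≤ s) (hmn : m ≤ n) (hC : 0 ≤ C)
    (hCD : C ≤ D) : IsControlled η h s n D := by
  intro d _ i f
  obtain ⟨g', h1, h2⟩ := hg d i f
  refine ⟨g', ?_, h2.trans (mul_pow_mul_energyLoss_mono d f hmn hC hCD)⟩
  have := opDist_triangle h g g'
  linarith

theorem IsControlled.mul {g h : SU 2} {r s : ℝ} {m n : ℕ} {C D : ℝ}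
    (hg : IsControlled η g r m C) (hC : 0 ≤ C) (hh : IsControlled η h s n D) (hD : 0 ≤ D) :
    IsControlled η (g * h) (r + s) (max m n) (C + D) := by
  intro d _ i f
  obtain ⟨g', h1, h2⟩ := hg d i f
  obtain ⟨h', h3, h4⟩ := hh d i f
  refine ⟨g' * h', (opDist_mul_le _ _ _ _).trans (add_le_add h1 h3), ?_⟩
  rw [embed_mul]
  refine (displacement_mul_le _ _ _ _).trans ?_
  have h5 := mul_pow_mul_energyLoss_mono (η := η) d f (le_max_left m n) hC le_rfl
  have h6 := mul_pow_mul_energyLoss_mono (η := η) d f (le_max_right m n) hD le_rfl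
  rw [add_mul, add_mul]
  linarith

theorem IsControlled.inv {g : SU 2} {r : ℝ} {m : ℕ} {C : ℝ} (hg : IsControlled η g r m C) :
    IsControlled η g⁻¹ r m C := by
  intro d _ i f
  obtain ⟨g', h1, h2⟩ := hg d i f
  refine ⟨g'⁻¹, by rwa [opDist_inv], ?_⟩
  rwa [embed_inv, displacement_inv]

variable (η) in
/-- The closed subgroup of the points that are controlled at every scale. -/
def controlledSubgroup : Subgroup (SU 2) where
  carrier := {g | ∀ r : ℝ, 0 < r → ∃ (m : ℕ) (C : ℝ), 0 ≤ C ∧ IsControlled η g r m C}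
  mul_mem' := by
    intro g h hg hh r hr
    obtain ⟨m, C, hC, h1⟩ := hg (r / 2) (by positivity)
    obtain ⟨n, D, hD, h2⟩ := hh (r / 2) (by positivity)
    exact ⟨_, _, add_nonneg hC hD, add_halves r ▸ h1.mul hC h2 hD⟩
  one_mem' := by
    intro r hr
    refine ⟨0, 0, le_rfl, fun d _ i f => ⟨1, by rw [opDist_self]; exact hr.le, ?_⟩⟩
    rw [embed_one]
    simp [displacement, l2]
  inv_mem' := by
    intro g hg r hr
    obtain ⟨m, C, hC, h1⟩ := hg r hr
    exact ⟨m, C, hC, h1.inv⟩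

theorem mem_controlledSubgroup {g : SU 2} : g ∈ controlledSubgroup η ↔
    ∀ r : ℝ, 0 < r → ∃ (m : ℕ) (C : ℝ), 0 ≤ C ∧ IsControlled η g r m C := Iff.rfl

theorem isClosed_controlledSubgroup : IsClosed (controlledSubgroup η : Set (SU 2)) := by
  refine isClosed_of_closure_subset fun g hg r hr => ?_
  obtain ⟨h, hgh, hh⟩ := mem_closure_iff_nhds.1 hg _ (opDist_lt_mem_nhds g (half_pos hr))
  obtain ⟨m, C, hC, h1⟩ := hh (r / 2) (half_pos hr)
  refine ⟨m, C, hC, h1.mono ?_ le_rfl hC le_rfl⟩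
  have : opDist g h < r / 2 := hgh
  linarith

/-- Points near `k` and near `l` both translate `f` close to the same function $Tf$. -/
theorem mul_inv_mem_controlledSubgroup {k l : SU 2} (hk : k ∈ η.support) (hl : l ∈ η.support) :
    k * l⁻¹ ∈ controlledSubgroup η := by
  rw [mem_controlledSubgroup]
  intro r hr
  obtain ⟨C, hC, h1⟩ := exists_translate_near_transition η hk (half_pos hr)
  obtain ⟨D, hD, h2⟩ := exists_translate_near_transition η hl (half_pos hr)
  refine ⟨1, C + D, add_nonneg hC hD, fun d _ i f => ?_⟩
  obtain ⟨k', hk', h3⟩ := h1 d i f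
  obtain ⟨l', hl', h4⟩ := h2 d i f
  refine ⟨k' * l'⁻¹, (opDist_mul_le _ _ _ _).trans ?_, ?_⟩
  · rw [opDist_inv]; linarith
  · rw [embed_mul, embed_inv, displacement_mul_inv]
    refine (l2_sub_le _ _ (transition (stepMeasure η d) f) _).trans ?_
    rw [l2_sub_comm _ (transition (stepMeasure η d) f)]
    rw [pow_one, add_mul, add_mul]
    linarith

/-- Conjugation by a point near `k` replaces `f` by a translate, which is close to $Tf$. Control of
`g` is applied to $Tf$, so that the choice of `g'` does not depend on `k'`; the loss of $Tf$ in `m`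
steps is at most that of `f` in `m + 1`. -/
theorem conj_mem_controlledSubgroup {k g : SU 2} (hk : k ∈ η.support)
    (hg : g ∈ controlledSubgroup η) : k * g * k⁻¹ ∈ controlledSubgroup η := by
  rw [mem_controlledSubgroup] at hg ⊢
  intro r hr
  obtain ⟨C, hC, h1⟩ := exists_translate_near_transition η hk (r := r / 3) (by positivity)
  obtain ⟨m, D, hD, h2⟩ := hg (r / 3) (by positivity)
  refine ⟨m + 1, D + 2 * C, by positivity, fun d _ i f => ?_⟩
  obtain ⟨k', hk', h3⟩ := h1 d i f
  obtain ⟨g', hg', h4⟩ := h2 d i (transition (stepMeasure η d) f)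
  refine ⟨k' * g' * k'⁻¹, ?_, ?_⟩
  · refine (opDist_mul_le _ _ _ _).trans ?_
    have := opDist_mul_le k k' g g'
    rw [opDist_inv]; linarith
  · rw [embed_mul, embed_mul, embed_inv, displacement_conj]
    refine (displacement_le_add _ _ (transition (stepMeasure η d) f) _).trans ?_
    have h5 := energyLoss_transition_le (stepMeasure η d) (haar d) m f
    have h6 : D * d ^ m * energyLoss (stepMeasure η d) (haar d) m (transition (stepMeasure η d) f) ≤
        D * d ^ m * energyLoss (stepMeasure η d) (haar d) (m + 1) f := by gcongr
    have hd : (1 : ℝ) ≤ d := by exact_mod_cast NeZero.one_le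
    have h7 : D * d ^ m * energyLoss (stepMeasure η d) (haar d) (m + 1) f ≤
        D * d ^ (m + 1) * energyLoss (stepMeasure η d) (haar d) (m + 1) f := by
      have := energyLoss_nonneg (stepMeasure η d) (haar d) (m + 1) f
      have := pow_le_pow_right₀ hd (Nat.le_succ m)
      gcongr
    have h8 := mul_pow_mul_energyLoss_mono (η := η) d f (Nat.le_add_left 1 m) hC le_rfl
    rw [pow_one] at h8
    linarith

theorem controlledSubgroup_eq_top (hη : Dense (Subgroup.closure η.support : Set (SU 2)))
    (g : SU 2) : g ∈ controlledSubgroup η := by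
  obtain ⟨V, W, h, -, -⟩ := exists_eq_commutator g
  rw [h]
  exact Subgroup.commutator_mem_of_dense isClosed_controlledSubgroup hη
    (fun k hk l hl => mul_inv_mem_controlledSubgroup hk hl)
    (fun k hk g hg => conj_mem_controlledSubgroup hk hg) V W

/-- Compactness: finitely many balls of radius `r / 2` suffice, with the largest `m` and the sum of
the constants. -/
theorem exists_forall_isControlled (hη : Dense (Subgroup.closure η.support : Set (SU 2))) {r : ℝ}
    (hr : 0 < r) : ∃ (m : ℕ) (C : ℝ), 0 ≤ C ∧ ∀ g, IsControlled η g r m C := by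
  choose m C hC h using fun g =>
    mem_controlledSubgroup.1 (controlledSubgroup_eq_top hη g) (r / 2) (half_pos hr)
  obtain ⟨t, -, ht⟩ := isCompact_univ.elim_nhds_subcover
    (fun g : SU 2 => {h | opDist g h < r / 2}) fun g _ => opDist_lt_mem_nhds g (half_pos hr)
  refine ⟨t.sup m, ∑ g ∈ t, C g, Finset.sum_nonneg fun g _ => hC g, fun g => ?_⟩
  obtain ⟨x, hx, hgx⟩ := Set.mem_iUnion₂.1 (ht (Set.mem_univ g))
  refine (h x).mono ?_ (Finset.le_sup hx) (hC x)
    (Finset.single_le_sum (f := C) (fun g _ => hC g) hx)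
  have : opDist x g < r / 2 := hgx
  rw [opDist_comm]
  linarith

end SU

/-! ### Lipschitz functions and contraction down to a given scale -/

namespace SU

open CompactWalk

section lipschitz

variable {d : ℕ}

theorem continuous_of_le_opDist {f : SU d → ℝ} (hf : ∀ g h, |f g - f h| ≤ opDist g h) :
    Continuous f := by
  refine continuous_iff_continuousAt.2 fun x => ?_
  rw [ContinuousAt, tendsto_iff_dist_tendsto_zero]
  have h : Filter.Tendsto (fun y => opDist x y) (nhds x) (nhds (opDist x x)) :=
    (continuous_opDist_left x).tendsto x
  rw [opDist_self] at h
  exact squeeze_zero (fun _ => dist_nonneg) (fun y => (hf y x).trans (opDist_comm y x).le) h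

/-- Left invariance of the metric keeps the class of 1-Lipschitz functions stable under the walk, so
the contraction estimate can be iterated. -/
theorem transition_lipschitz (ν : Measure (SU d)) [IsProbabilityMeasure ν] {f : C(SU d, ℝ)}
    (hf : ∀ g h, |f g - f h| ≤ opDist g h) (x y : SU d) :
    |transition ν f x - transition ν f y| ≤ opDist x y := by
  have hi : ∀ x, Integrable (fun g => f (g * x)) ν := fun x =>
    integrable_continuousMap ν ⟨fun g => f (g * x), by fun_prop⟩
  rw [transition_apply, transition_apply, ← integral_sub (hi x) (hi y)]
  have := norm_integral_le_of_norm_le_const (μ := ν) (f := fun g => f (g * x) - f (g * y))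
    (C := opDist x y) (.of_forall fun g => (hf _ _).trans (opDist_mul_left g x y).le)
  simpa using this

theorem iterate_transition_lipschitz (ν : Measure (SU d)) [IsProbabilityMeasure ν] (n : ℕ)
    {f : C(SU d, ℝ)} (hf : ∀ g h, |f g - f h| ≤ opDist g h) (x y : SU d) :
    |(transition ν)^[n] f x - (transition ν)^[n] f y| ≤ opDist x y := by
  induction n generalizing f with
  | zero => exact hf x y
  | succ n ih => exact ih (transition_lipschitz ν hf)

theorem displacement_le_opDist {f : C(SU d, ℝ)} (hf : ∀ g h, |f g - f h| ≤ opDist g h)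
    (g : SU d) : displacement (haar d) f g ≤ opDist g 1 := by
  refine l2_le_of_abs_le _ fun x => ?_
  refine (hf _ _).trans (le_of_eq ?_)
  rw [opDist_comm, ← opDist_mul_right x g 1, one_mul]

/-- A Lipschitz function with small `L²` norm is uniformly small. -/
theorem abs_le_of_l2_le (hd : 1 ≤ d) {f : C(SU d, ℝ)} (hf : ∀ g h, |f g - f h| ≤ opDist g h)
    {ε : ℝ} (hε : 0 < ε) (hε1 : ε ≤ 1)
    (h : l2 (haar d) f ≤ (ε / (14 * (d : ℝ) ^ 2)) ^ (d ^ 2 + 1)) (x : SU d) : |f x| ≤ ε := by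
  by_contra! hx
  have hd' : (1 : ℝ) ≤ (d : ℝ) ^ 2 := one_le_pow₀ (by exact_mod_cast hd)
  -- If $|f(x)|>\varepsilon$, then $|f|\ge\varepsilon/2$ on the ball of radius $\varepsilon/2$,
  -- whose volume is at least $q^{2d^2}$. Since $q<\varepsilon/2$, this gives $\|f\|^2>q^{2d^2+2}$,
  -- whence the exponent $d^2+1$.
  set q := ε / (14 * (d : ℝ) ^ 2) with hq
  have hq0 : 0 < q := by positivity
  set B := {g : SU d | opDist x g ≤ ε / 2} with hB
  have hBc : IsClosed B :=
    isClosed_le (continuous_opDist_left x) continuous_const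
  have hvol := le_haar_ball hd (half_pos hε) (by linarith) x
  have hq' : ε / 2 / (7 * (d : ℝ) ^ 2) = q := by rw [hq]; field_simp; norm_num
  rw [hq'] at hvol
  have hint : Integrable (fun g => f g ^ 2) (haar d) := integrable_continuousMap _ (f ^ 2)
  have h1 : (ε / 2) ^ 2 * (haar d).real B ≤ ∫ g, f g ^ 2 ∂(haar d) := by
    refine le_trans ?_ (setIntegral_le_integral (s := B) hint (.of_forall fun g => sq_nonneg _))
    have := setIntegral_mono_on (μ := haar d) (s := B) (f := fun _ => (ε / 2) ^ 2)
      (integrable_const _).integrableOn hint.integrableOn hBc.measurableSet (fun g hg => by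
        have h2 := hf x g
        have h3 : opDist x g ≤ ε / 2 := hg
        have h4 := abs_sub_abs_le_abs_sub (f x) (f g)
        rw [← sq_abs (f g)]
        exact pow_le_pow_left₀ (by positivity) (by linarith) 2)
    rw [setIntegral_const, smul_eq_mul] at this
    linarith
  rw [← l2_sq] at h1
  have h2 : l2 (haar d) f ^ 2 ≤ q ^ 2 * q ^ (2 * d ^ 2) := by
    refine (pow_le_pow_left₀ (l2_nonneg _ _) h 2).trans (le_of_eq ?_)
    rw [← pow_mul, ← pow_add]; congr 1; ring
  have h3 : q < ε / 2 := by
    rw [hq, div_lt_div_iff₀ (by positivity) two_pos]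
    nlinarith
  have h4 : q ^ 2 < (ε / 2) ^ 2 := pow_lt_pow_left₀ h3 hq0.le two_ne_zero
  have h5 : 0 < q ^ (2 * d ^ 2) := by positivity
  have h6 := mul_lt_mul_of_pos_right h4 h5
  have h7 := mul_le_mul_of_nonneg_left hvol (sq_nonneg (ε / 2))
  linarith

end lipschitz

section walk

variable {η : Measure (SU 2)} [IsProbabilityMeasure η] {d : ℕ} [d.AtLeastTwo]

theorem integral_walkLaw (x : SU d) (n : ℕ) (f : C(SU d, ℝ)) :
    ∫ g, f g ∂(walkLaw η d x n) = (transition (stepMeasure η d))^[n] f x := by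
  induction n generalizing f with
  | zero => simp [walkLaw]
  | succ n ih =>
    have hm : walkLaw η d x (n + 1) = (stepMeasure η d).mconv (walkLaw η d x n) := rfl
    have : IsProbabilityMeasure ((stepMeasure η d).mconv (walkLaw η d x n)) :=
      instIsProbabilityMeasureWalk η d x (n + 1)
    rw [hm, integral_mconv (integrable_continuousMap _ f), Function.iterate_succ_apply, ← ih,
      integral_integral_swap (integrable_uncurry_comp_mul _ _ f)]
    rfl

/-- The norm of a Lipschitz function is controlled by its energy loss, up to a small error. -/
theorem l2_le_energyLoss {m : ℕ} {C : ℝ} (hC : ∀ g, IsControlled η g (1 / 128) m C)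
    {f : C(SU d, ℝ)} (hf : ∀ g h, |f g - f h| ≤ opDist g h) (hf0 : ∫ x, f x ∂(haar d) = 0)
    (k : ℕ) : l2 (haar d) f ≤ (d : ℝ) ^ 2 *
      (5 ^ k * (C * d ^ m * energyLoss (stepMeasure η d) (haar d) m f) +
        Real.exp (-(Real.log 2 * (3 / 2) ^ k))) := by
  refine l2_le_of_displacement_le _ hf0 fun g => ?_
  refine length_le_of_embed_le (fun g h => displacement_mul_le _ f g h)
    (fun g => displacement_inv _ f g) (fun i γ => ?_) g
  refine length_le_of_exists_near (ρ := fun γ => displacement (haar d) f (embed (ne_add_one i) γ))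
    (fun g h => ?_) (fun g => ?_) (fun g => ?_) (fun g => hC g d i f) k γ
  · simp only [embed_mul]; exact displacement_mul_le _ f _ _
  · simp only [embed_inv]; exact displacement_inv _ f _
  · refine (displacement_le_opDist hf _).trans ?_
    have := opDist_embed_le (ne_add_one i) g 1
    rwa [embed_one] at this

theorem iterate_transition_integral (n : ℕ) {f : C(SU d, ℝ)} (hf0 : ∫ x, f x ∂(haar d) = 0) :
    ∫ x, (transition (stepMeasure η d))^[n] f x ∂(haar d) = 0 := by
  induction n generalizing f with
  | zero => exact hf0
  | succ n ih => exact ih (by rw [integral_transition, hf0])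

/-- Above the scale `δ`, the `L²` norm contracts by a definite factor every `m` steps. -/
theorem l2_iterate_le {m : ℕ} {C : ℝ} (hC : ∀ g, IsControlled η g (1 / 128) m C)
    {f : C(SU d, ℝ)} (hf : ∀ g h, |f g - f h| ≤ opDist g h) (hf0 : ∫ x, f x ∂(haar d) = 0)
    {δ B : ℝ} {k : ℕ}
    (hδ : (d : ℝ) ^ 2 * Real.exp (-(Real.log 2 * (3 / 2) ^ k)) ≤ δ / 2) (hB1 : 1 ≤ B)
    (hB : 2 * (d : ℝ) ^ (m + 2) * 5 ^ k * C ≤ B) (J : ℕ) :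
    l2 (haar d) ((transition (stepMeasure η d))^[m * J] f) ≤ δ ∨
      l2 (haar d) ((transition (stepMeasure η d))^[m * J] f) ^ 2 ≤
        (1 - 1 / B ^ 2) ^ J * l2 (haar d) f ^ 2 := by
  induction J with
  | zero => right; simp
  | succ J ih =>
    set F := (transition (stepMeasure η d))^[m * J] f with hF
    have hF' : (transition (stepMeasure η d))^[m * (J + 1)] f =
        (transition (stepMeasure η d))^[m] F := by
      rw [hF, ← Function.iterate_add_apply]; congr 1; ring_nf
    rw [hF']
    by_cases hle : l2 (haar d) F ≤ δ
    · exact Or.inl ((l2_iterate_transition_le _ _ F m).trans hle)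
    right
    have h1 := l2_le_energyLoss hC (iterate_transition_lipschitz (stepMeasure η d) (m * J) hf)
      (iterate_transition_integral (η := η) (m * J) hf0) k
    rw [← hF] at h1
    push Not at hle
    have hE := energyLoss_nonneg (stepMeasure η d) (haar d) m F
    have hE2 := energyLoss_sq (stepMeasure η d) (haar d) m F
    set E := energyLoss (stepMeasure η d) (haar d) m F
    -- Above scale `δ`, the Solovay-Kitaev error is at most half of the norm and is absorbed in the
    -- left-hand side.
    have h2 : l2 (haar d) F ≤ B * E := by
      have h3 : (2 * (d : ℝ) ^ (m + 2) * 5 ^ k * C) * E ≤ B * E := by gcongr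
      have h4 : (2 * (d : ℝ) ^ (m + 2) * 5 ^ k * C) * E =
        2 * ((d : ℝ) ^ 2 * (5 ^ k * (C * d ^ m * E))) := by ring
      rw [mul_add] at h1
      linarith
    have h3 : l2 (haar d) F ^ 2 ≤ B ^ 2 * E ^ 2 := by
      rw [← mul_pow]; exact pow_le_pow_left₀ (l2_nonneg _ _) h2 2
    have hB2 : 1 ≤ B ^ 2 := one_le_pow₀ hB1
    have h4 : l2 (haar d) ((transition (stepMeasure η d))^[m] F) ^ 2 ≤
        (1 - 1 / B ^ 2) * l2 (haar d) F ^ 2 := by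
      have : 1 / B ^ 2 * l2 (haar d) F ^ 2 ≤ E ^ 2 := by
        rw [div_mul_eq_mul_div, one_mul, div_le_iff₀ (by positivity)]
        linarith
      linarith
    have h5 : 0 ≤ 1 - 1 / B ^ 2 := by
      rw [sub_nonneg, div_le_one (by positivity)]; exact hB2
    rcases ih with h | h
    · exact absurd h (not_le.2 hle)
    · refine h4.trans ((mul_le_mul_of_nonneg_left h h5).trans (le_of_eq ?_))
      rw [pow_succ]; ring

/-- The initial norm is at most 2, the diameter bound, and $2B^2\Lambda$ contractions gain
$e^{-2\Lambda}\le(\delta/2)^2$ in the squared norm. -/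
theorem l2_iterate_le_of_log_le {m : ℕ} {C : ℝ}
    (hC : ∀ g, IsControlled η g (1 / 128) m C)
    {f : C(SU d, ℝ)} (hf : ∀ g h, |f g - f h| ≤ opDist g h) (hf0 : ∫ x, f x ∂(haar d) = 0)
    {δ B Λ : ℝ} {k J : ℕ} (hδ0 : 0 < δ) (hΛ : 2 * (d : ℝ) ^ 2 / δ ≤ Real.exp Λ)
    (hk : Λ ≤ Real.log 2 * (3 / 2) ^ k) (hB1 : 1 ≤ B)
    (hB : 2 * (d : ℝ) ^ (m + 2) * 5 ^ k * C ≤ B) (hJ : 2 * B ^ 2 * Λ ≤ J) :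
    l2 (haar d) ((transition (stepMeasure η d))^[m * J] f) ≤ δ := by
  have hd : (1 : ℝ) ≤ (d : ℝ) ^ 2 := one_le_pow₀ (by exact_mod_cast NeZero.one_le)
  have hexp : (d : ℝ) ^ 2 * Real.exp (-Λ) ≤ δ / 2 := by
    rw [Real.exp_neg, ← div_eq_mul_inv, div_le_iff₀ (Real.exp_pos _)]
    rw [div_le_iff₀ hδ0] at hΛ
    linarith
  have hδ : (d : ℝ) ^ 2 * Real.exp (-(Real.log 2 * (3 / 2) ^ k)) ≤ δ / 2 := by
    refine le_trans (mul_le_mul_of_nonneg_left (Real.exp_le_exp.2 (neg_le_neg hk)) ?_) hexp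
    positivity
  rcases l2_iterate_le hC hf hf0 hδ hB1 hB J with h | h
  · exact h
  refine le_of_sq_le_sq (h.trans ?_) hδ0.le
  have hf2 : l2 (haar d) f ≤ 2 := by
    refine l2_le_of_displacement_le _ hf0 fun g => ?_
    exact (displacement_le_opDist hf g).trans (opDist_le_two _ _)
  have h1 : (1 - 1 / B ^ 2) ^ J ≤ Real.exp (-(2 * Λ)) := by
    have hB2 : 1 ≤ B ^ 2 := one_le_pow₀ hB1
    have h2 : 1 - 1 / B ^ 2 ≤ Real.exp (-(1 / B ^ 2)) := by
      have := Real.add_one_le_exp (-(1 / B ^ 2)); linarith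
    have h5 : 0 ≤ 1 - 1 / B ^ 2 := by
      rw [sub_nonneg, div_le_one (by positivity)]; exact hB2
    refine (pow_le_pow_left₀ h5 h2 J).trans ?_
    rw [← Real.exp_nat_mul, Real.exp_le_exp, mul_neg, neg_le_neg_iff, mul_one_div,
      le_div_iff₀ (by positivity)]
    linarith
  have h3 : Real.exp (-Λ) ≤ δ / 2 :=
    le_trans (le_mul_of_one_le_left (Real.exp_nonneg _) hd) hexp
  have h4 : Real.exp (-(2 * Λ)) = Real.exp (-Λ) ^ 2 := by
    rw [← Real.exp_nat_mul]; congr 1; push_cast; ring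
  calc (1 - 1 / B ^ 2) ^ J * l2 (haar d) f ^ 2 ≤ (δ / 2) ^ 2 * 2 ^ 2 := by
        refine mul_le_mul (h1.trans ?_) (pow_le_pow_left₀ (l2_nonneg _ _) hf2 2) (sq_nonneg _)
          (sq_nonneg _)
        rw [h4]
        exact pow_le_pow_left₀ (Real.exp_nonneg _) h3 2
    _ = δ ^ 2 := by ring

/-- The $L^2$ bound at time `n₀` becomes a uniform bound, which covers every starting point and
persists at later times because the transition operator contracts the supremum norm. -/
theorem isHaarApprox_of_l2_le {ε : ℝ} (hε : 0 < ε) (hε1 : ε ≤ 1) {n₀ : ℕ}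
    (h : ∀ f : C(SU d, ℝ), (∀ g h, |f g - f h| ≤ opDist g h) → ∫ x, f x ∂(haar d) = 0 →
      l2 (haar d) ((transition (stepMeasure η d))^[n₀] f) ≤
        (ε / (14 * (d : ℝ) ^ 2)) ^ (d ^ 2 + 1)) {n : ℕ} (hn : n₀ ≤ n) (x : SU d) :
    IsHaarApprox (walkLaw η d x n) ε := by
  intro f hf
  set c := ∫ g, f g ∂(haar d) with hc
  let f' : C(SU d, ℝ) := ⟨f, continuous_of_le_opDist hf⟩
  let F : C(SU d, ℝ) := f' - ContinuousMap.const _ c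
  have hF : ∀ g, F g = f g - c := fun g => rfl
  have hFl : ∀ g h, |F g - F h| ≤ opDist g h := fun g h => by
    rw [hF, hF, sub_sub_sub_cancel_right]; exact hf g h
  have hint : ∀ (μ : Measure (SU d)) [IsProbabilityMeasure μ], ∫ g, F g ∂μ = ∫ g, f g ∂μ - c := by
    intro μ _
    simp_rw [hF]
    have hi : Integrable f μ := integrable_continuousMap μ f'
    rw [integral_sub hi (integrable_const _)]
    simp
  have hF0 : ∫ g, F g ∂(haar d) = 0 := by rw [hint, hc, sub_self]
  have h1 := abs_le_of_l2_le NeZero.one_le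
    (iterate_transition_lipschitz (stepMeasure η d) n₀ hFl) hε hε1 (h F hFl hF0)
  rw [← hint, integral_walkLaw]
  obtain ⟨j, rfl⟩ := Nat.exists_eq_add_of_le hn
  rw [add_comm, Function.iterate_add_apply]
  exact iterate_transition_abs_le _ h1 j x

end walk

/-- The logarithmic size of the target scale is polynomial in `d log (1/ε)`. -/
theorem log_scale_le {d : ℕ} (hd : 2 ≤ d) {ε : ℝ} (hε : 0 < ε) (hε1 : ε ≤ 1 / 2) :
    Real.log (2 * (d : ℝ) ^ 2 / (ε / (14 * (d : ℝ) ^ 2)) ^ (d ^ 2 + 1)) ≤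
      69 * ((d : ℝ) * Real.log (1 / ε)) ^ 3 := by
  have hd' : (2 : ℝ) ≤ d := by exact_mod_cast hd
  have hl2 : (1 : ℝ) / 2 < Real.log 2 := by linarith [Real.log_two_gt_d9]
  have hl : Real.log 2 ≤ Real.log (1 / ε) :=
    Real.log_le_log two_pos (by rw [le_div_iff₀ hε]; linarith)
  set l := Real.log (1 / ε) with hldef
  set y := (d : ℝ) * l with hy
  have hdy : (d : ℝ) ≤ 2 * y := by rw [hy]; nlinarith
  have hly : l ≤ y := by rw [hy]; nlinarith
  have hy1 : 1 ≤ y := by rw [hy]; nlinarith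
  have hlogd : Real.log d ≤ 2 * y := by
    have := Real.log_le_sub_one_of_pos (by linarith : (0 : ℝ) < d)
    linarith
  have hlogd0 : 0 ≤ Real.log d := Real.log_nonneg (by linarith)
  have hl14 : Real.log 14 ≤ 3 := by
    have h16 : Real.log 14 ≤ Real.log (2 ^ 4) := Real.log_le_log (by norm_num) (by norm_num)
    rw [Real.log_pow] at h16
    have := Real.log_two_lt_d9
    push_cast at h16
    linarith
  have e : Real.log (2 * (d : ℝ) ^ 2 / (ε / (14 * (d : ℝ) ^ 2)) ^ (d ^ 2 + 1)) =
      Real.log 2 + 2 * Real.log d +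
        ((d : ℝ) ^ 2 + 1) * (l + (Real.log 14 + 2 * Real.log d)) := by
    have hd0 : (d : ℝ) ≠ 0 := by positivity
    rw [Real.log_div (by positivity) (by positivity), Real.log_mul (by positivity) (by positivity),
      Real.log_pow, Real.log_pow, Real.log_div hε.ne' (by positivity),
      Real.log_mul (by positivity) (by positivity), Real.log_pow, hldef, one_div, Real.log_inv]
    push_cast
    ring
  rw [e]
  have h1 : Real.log 2 ≤ y := hl.trans hly
  have h2 : (d : ℝ) ^ 2 + 1 ≤ 8 * y ^ 2 := by nlinarith
  have h3 : l + (Real.log 14 + 2 * Real.log d) ≤ 8 * y := by linarith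
  have h4 : 0 ≤ l + (Real.log 14 + 2 * Real.log d) := by
    have : 0 ≤ Real.log 14 := Real.log_nonneg (by norm_num)
    linarith
  have h5 : ((d : ℝ) ^ 2 + 1) * (l + (Real.log 14 + 2 * Real.log d)) ≤ 8 * y ^ 2 * (8 * y) :=
    mul_le_mul h2 h3 h4 (by positivity)
  -- The three terms are at most $y$, $4y$ and $64y^3$, and $1+4+64=69$.
  have h6 : y ≤ y ^ 3 := le_self_pow₀ hy1 (by norm_num)
  nlinarith

end SU

/-! ### Choice of parameters -/

theorem proposition2 (η : MeasureTheory.Measure (SU 2)) [MeasureTheory.IsProbabilityMeasure η]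
    (hη : Dense (Subgroup.closure η.support : Set (SU 2))) :
    ∃ C : ℝ, 0 < C ∧ ∀ (d : ℕ) [d.AtLeastTwo] (ε : ℝ), 0 < ε → ε ≤ 1 / 2 →
      ∃ n₀ : ℕ, (n₀ : ℝ) ≤ C * ((d : ℝ) * Real.log (1 / ε)) ^ C ∧
        ∀ n : ℕ, n₀ ≤ n → ∀ x : SU d, SU.IsHaarApprox (SU.walkLaw η d x n) ε := by
  obtain ⟨m, A, hA0, hA⟩ := SU.exists_forall_isControlled hη (r := 1 / 128) (by norm_num)
  set K : ℝ := m * (3 * (2 * 2 ^ (m + 2) * (3 * 69) ^ 4 * (A + 1)) ^ 2 * 69) with hK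
  have hK0 : 0 ≤ K := by positivity
  -- The time is at most $Ky^{2m+31}$ with $y=d\log(1/\varepsilon)\ge 1$; the sum serves as both
  -- factor and exponent. The degree arises from `B` of degree $(m+2)+12$ in `y`, squared, times `Λ`
  -- of degree 3.
  refine ⟨K + (2 * m + 31 : ℕ), by positivity, fun d _ ε hε hε1 => ?_⟩
  have hd2 : 2 ≤ d := Nat.AtLeastTwo.prop
  have hd : (2 : ℝ) ≤ d := by exact_mod_cast hd2
  have hl2 : (1 : ℝ) / 2 < Real.log 2 := by linarith [Real.log_two_gt_d9]
  have hl2' : Real.log 2 < 1 := by linarith [Real.log_two_lt_d9]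
  have hl : Real.log 2 ≤ Real.log (1 / ε) :=
    Real.log_le_log two_pos (by rw [le_div_iff₀ hε]; linarith)
  have hΛy := SU.log_scale_le hd2 hε hε1
  set y := (d : ℝ) * Real.log (1 / ε) with hy
  have hdy : (d : ℝ) ≤ 2 * y := by rw [hy]; nlinarith
  have hy1 : 1 ≤ y := by rw [hy]; nlinarith
  set δ := (ε / (14 * (d : ℝ) ^ 2)) ^ (d ^ 2 + 1) with hδ
  have hδ0 : 0 < δ := by positivity
  have hδ1 : δ ≤ 1 := by
    refine pow_le_one₀ (by positivity) ?_
    rw [div_le_one (by positivity)]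
    nlinarith
  set Λ := Real.log (2 * (d : ℝ) ^ 2 / δ) with hΛ
  have hexpΛ : 2 * (d : ℝ) ^ 2 / δ = Real.exp Λ := (Real.exp_log (by positivity)).symm
  have hΛ1 : 1 ≤ Λ := by
    rw [hΛ, Real.le_log_iff_exp_le (by positivity), le_div_iff₀ hδ0]
    have := Real.exp_one_lt_d9
    nlinarith [Real.exp_pos 1]
  -- The depth `j + 1` is the least that brings the Solovay-Kitaev error below $e^{-\Lambda}$;
  -- minimality keeps $5^{j+1}$ polynomial in `Λ`, through $5\le(3/2)^4$.
  obtain ⟨j, hj1, hj2⟩ := exists_nat_pow_near (x := Λ / Real.log 2) (y := 3 / 2)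
    (by rw [le_div_iff₀ (by linarith)]; linarith) (by norm_num)
  have hk : Λ ≤ Real.log 2 * (3 / 2) ^ (j + 1) := by
    rw [div_lt_iff₀ (by linarith)] at hj2
    linarith
  have h5k : (5 : ℝ) ^ (j + 1) ≤ (3 * Λ) ^ 4 := by
    have h1 : (3 / 2 : ℝ) ^ (j + 1) ≤ 3 * Λ := by
      rw [le_div_iff₀ (by linarith)] at hj1
      rw [pow_succ]
      have : 0 < (3 / 2 : ℝ) ^ j := by positivity
      nlinarith
    calc (5 : ℝ) ^ (j + 1) ≤ ((3 / 2) ^ 4) ^ (j + 1) :=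
          pow_le_pow_left₀ (by norm_num) (by norm_num) _
      _ = ((3 / 2) ^ (j + 1)) ^ 4 := by rw [← pow_mul, ← pow_mul, mul_comm]
      _ ≤ _ := pow_le_pow_left₀ (by positivity) h1 4
  set B := 2 * (d : ℝ) ^ (m + 2) * (3 * Λ) ^ 4 * (A + 1) with hB
  have hB1 : 1 ≤ B := by
    have h1 : 1 ≤ (d : ℝ) ^ (m + 2) := one_le_pow₀ (by linarith)
    have h2 : 1 ≤ (3 * Λ) ^ 4 := one_le_pow₀ (by linarith)
    exact one_le_mul_of_one_le_of_one_le (one_le_mul_of_one_le_of_one_le (by linarith) h2)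
      (by linarith)
  have hB' : 2 * (d : ℝ) ^ (m + 2) * 5 ^ (j + 1) * A ≤ B := by
    rw [hB]
    gcongr
    linarith
  refine ⟨m * ⌈2 * B ^ 2 * Λ⌉₊, ?_, fun n hn x => SU.isHaarApprox_of_l2_le hε (by linarith)
    (fun f hf hf0 => SU.l2_iterate_le_of_log_le hA hf hf0 hδ0 hexpΛ.le hk hB1 hB'
      (Nat.le_ceil _)) hn x⟩
  have hB2 : 1 ≤ B ^ 2 * Λ := one_le_mul_of_one_le_of_one_le (one_le_pow₀ hB1) hΛ1
  have hceil : (⌈2 * B ^ 2 * Λ⌉₊ : ℝ) ≤ 3 * B ^ 2 * Λ := by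
    have := Nat.ceil_lt_add_one (show 0 ≤ 2 * B ^ 2 * Λ by positivity)
    linarith
  have hBle : B ≤ 2 * (2 * y) ^ (m + 2) * (3 * (69 * y ^ 3)) ^ 4 * (A + 1) := by
    rw [hB]; gcongr
  have hmain : ((m * ⌈2 * B ^ 2 * Λ⌉₊ : ℕ) : ℝ) ≤ K * y ^ (2 * m + 31) := by
    push_cast
    calc (m : ℝ) * ⌈2 * B ^ 2 * Λ⌉₊ ≤ m * (3 * B ^ 2 * Λ) := by gcongr
      _ ≤ m * (3 * (2 * (2 * y) ^ (m + 2) * (3 * (69 * y ^ 3)) ^ 4 * (A + 1)) ^ 2 *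
          (69 * y ^ 3)) := by gcongr
      _ = K * y ^ (2 * m + 31) := by
        rw [hK, mul_pow 2 y (m + 2)]
        have e : y ^ (2 * m + 31) = (y ^ (m + 2)) ^ 2 * y ^ 27 := by
          rw [← pow_mul, ← pow_add]; congr 1; ring
        rw [e]; ring
  refine hmain.trans ?_
  have hrp : y ^ (2 * m + 31) ≤ y ^ (K + (2 * m + 31 : ℕ)) := by
    rw [← Real.rpow_natCast]
    exact Real.rpow_le_rpow_of_exponent_le hy1 (by linarith)
  have hpos : (0 : ℝ) ≤ (2 * m + 31 : ℕ) := Nat.cast_nonneg _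
  exact mul_le_mul (by linarith) hrp (by positivity) (by positivity)
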